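/- Let $L$ be a first-order language and $T$ a complete, model-complete and stable $L$-theory. Let $L_\sigma=L\cup\{\sigma\}$ with $\sigma$ a new unary function symbol, and let $T_\sigma$ be the $L_\sigma$-theory consisting of $T$ and axioms saying that $\sigma$ is an $L$-automorphism. For $M\models T$, let $S_n(M)$ be the set of complete $n$-types over $M$. Tuples are finite. Let $R_{\mathfrak g}$ be a relation on pairs $(p(x),\varphi(x,b))$, where $p\in S_n(M)$ for some $n$ and some $M\models T$, $\varphi(x,z)$ is an $L$-formula, $b$ is a tuple in $M$ and $\varphi(x,b)\in p$; if the pair is in $R_{\mathfrak g}$, we say that $p$ is generic in $\varphi(x,b)$. An $L$-formula $\psi(x,z)$ is *nice* if for every $M\models T$ and every $b$ in $M$ with $\psi(x,b)\neq\emptyset$ there is a unique type over $M$ that is generic in $\psi(x,b)$. For a type $p$ over $M$ let $N(p)$ be the set of formulas $\psi(x,b)$, with $\psi(x,z)$ nice and $b$ in $M$, such that $p$ is generic in $\psi(x,b)$. The type $p$ is *nice* if every formula of $p$ is implied (in $M$) by some formula of $N(p)$. The relation $R_{\mathfrak g}$ is a *geometric notion of genericity* for $T$ if the following hold. 1. (Invariance)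 If $e:M\cong N$ is an isomorphism of models of $T$, then $p$ is generic in $\varphi(x,b)$ if and only if $e(p)$ is generic in $\varphi(x,e(b))$. 2. (Coherence) If $M\preccurlyeq N$ are models of $T$, $\varphi(x,z)$ is nice, $b$ is in $M$ and $\varphi(x,b)\neq\emptyset$, then the generic type of $\varphi(x,b)$ over $N$ restricts to its generic type over $M$. 3. (Enough nice types) For every $M\models T$ and $p_0\in S_n(M)$ there are $m$ and a nice type $p\in S_{n+m}(M)$ whose projection to the first $n$ coordinates is $p_0$. 4. (Definability of generic projections) Let $x_1$ be a subtuple of $x$, let $\psi(x,z)$ and $\varphi(x_1,z_1)$ be nice, let $b,b_1$ be tuples in $M\models T$ with $\psi(x,b)\neq\emptyset$ and $M\models\forall x\,(\psi(x,b)\to\varphi(x_1,b_1))$, and assume that the generic type of $\psi(x,b)$ over $M$ projects onto the generic type of $\varphi(x_1,b_1)$ over $M$. Then there is an $L$-formula $\theta(z,z_1)\in\operatorname{tp}(b\,b_1)$ such that for every $M'\models T$ and all $b',b_1'$ in $M'$ with $M'\models\theta(b',b_1')$ one has $\psi(x,b')\neq\emptyset$, $M'\models\forall x\,(\psi(x,b')\to\varphi(x_1,b_1'))$,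 and the generic type of $\psi(x,b')$ over $M'$ projects onto the generic type of $\varphi(x_1,b_1')$ over $M'$. (We say that such a $\theta$ *witnesses definability* for the pair $(\psi,\varphi(x_1,z_1))$.) Suppose that $R_{\mathfrak g}$ is a geometric notion of genericity for $T$. Then $T_\sigma$ has a model companion $TA$, and $TA$ is axiomatised by $T_\sigma$ together with the following *geometric axioms*. Let $M\models T$, let $\sigma$ be an automorphism of $M$, and let $\tilde p(x,x',x_r)$ be a nice type over $M$ which projects onto nice types $p(x)$ and $p'(x')$ over $M$, where $x$ and $x'$ have the same length and $p'=\sigma(p)$. Let $\psi(x,x',x_r,\tilde b)\in N(\tilde p)$ and $\varphi(x,b)\in N(p)$ (with $\psi$ and $\varphi$ nice) be such that $\psi(x,x',x_r,\tilde b)$ implies $\varphi(x,b)\wedge\varphi(x',\sigma(b))$ in $M$. Let $\theta(\tilde z,z)\in\operatorname{tp}(\tilde b\,b)$ witness definability for the pair $(\psi,\varphi(x,z))$ and let $\theta'(\tilde z,z')\in\operatorname{tp}(\tilde b\,\sigma(b))$ witness definability for the pair $(\psi,\varphi(x',z'))$. The axiom for these choices is $$\forall \tilde z\,\forall z\,\exists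 x\,\exists x_r\,\bigl[\theta(\tilde z,z)\wedge\theta'(\tilde z,\sigma(z))\rightarrow\psi(x,\sigma(x),x_r,\tilde z)\bigr].$$ Here a theory $T'$ is a model companion of a theory $T''$ in the same language if $T'$ is model-complete (every embedding between models of $T'$ is elementary), every model of $T''$ embeds into a model of $T'$, and every model of $T'$ embeds into a model of $T''$. -/

import Mathlib

universe u v

open FirstOrder FirstOrder.Language

namespace GenericAutomorphism

noncomputable section

/-! ## Stability, model-completeness, model companions

All models are nonempty (as for Mathlib's `Theory.ModelType`) and live in `Type (max u v)`, where
`L : FirstOrder.Language.{u, v}`; by Löwenheim–Skolem and compactness nothing below depends on this choice. -/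

/-- The type of models of a theory, at the universe level of the language. -/
abbrev ModelOf {L : FirstOrder.Language.{u, v}} (T : L.Theory) : Type (max u v + 1) :=
  Theory.ModelType.{u, v, max u v} T

/-- A theory is model-complete if every embedding between two of its models is elementary. -/
def IsModelComplete {L : FirstOrder.Language.{u, v}} (T : L.Theory) : Prop :=
  ∀ (M N : ModelOf T) (f : M ↪[L] N) (n : ℕ) (φ : L.Formula (Fin n)) (a : Fin n → M),
    φ.Realize (fun i => f (a i)) ↔ φ.Realize a

/-- A theory is stable if no formula has the order property in any of its models. -/
def IsStable {L : FirstOrder.Language.{u, v}} (T : L.Theory) : Prop :=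
  ∀ (m n : ℕ) (φ : L.Formula (Fin m ⊕ Fin n)) (M : ModelOf T)
    (a : ℕ → Fin m → M) (b : ℕ → Fin n → M),
    ¬ ∀ i j : ℕ, φ.Realize (Sum.elim (a i) (b j)) ↔ i < j

/-- `T'` is a model companion of `T`: `T'` is model-complete, every model of `T` embeds into a model
of `T'`, and every model of `T'` embeds into a model of `T`. -/
def IsModelCompanion {L : FirstOrder.Language.{u, v}} (T T' : L.Theory) : Prop :=
  IsModelComplete T' ∧
  (∀ M : ModelOf T, ∃ N : ModelOf T', Nonempty (M ↪[L] N)) ∧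
  (∀ N : ModelOf T', ∃ M : ModelOf T, Nonempty (N ↪[L] M))

/-! ## The theory `T_σ` of models of `T` with an automorphism -/

/-- The function symbols of the language with a single unary function symbol `σ`. -/
inductive SigmaFunctions : ℕ → Type
  | sigma : SigmaFunctions 1

/-- The language with a single unary function symbol `σ`. -/
def sigmaLanguage : FirstOrder.Language.{0, 0} := ⟨SigmaFunctions, fun _ => Empty⟩

/-- The language `L_σ = L ∪ {σ}`. -/
abbrev LSigma (L : FirstOrder.Language.{u, v}) : FirstOrder.Language.{u, v} := L.sum sigmaLanguage

/-- The `L_σ`-term `σ(t)`. -/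
def sigmaTerm {L : FirstOrder.Language.{u, v}} {α : Type*} (t : (LSigma L).Term α) : (LSigma L).Term α :=
  Functions.apply₁ ((LHom.sumInr : sigmaLanguage →ᴸ LSigma L).onFunction SigmaFunctions.sigma) t

/-- `∀ x y, σ(x) = σ(y) → x = y`. -/
def sigmaInjective (L : FirstOrder.Language.{u, v}) : (LSigma L).Sentence :=
  ∀' ∀' ((sigmaTerm (&0) =' sigmaTerm (&1)) ⟹ (&0 =' &1))

/-- `∀ x, ∃ y, σ(y) = x`. -/
def sigmaSurjective (L : FirstOrder.Language.{u, v}) : (LSigma L).Sentence :=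
  ∀' ∃' (sigmaTerm (&1) =' &0)

/-- `∀ x, σ(f(x)) = f(σ(x))`, for a function symbol `f` of `L`. -/
def sigmaCommutes {L : FirstOrder.Language.{u, v}} {n : ℕ} (f : L.Functions n) : (LSigma L).Sentence :=
  BoundedFormula.alls
    (sigmaTerm (Term.func ((LHom.sumInl : L →ᴸ LSigma L).onFunction f)
        (fun i => (Term.var (Sum.inr i) : (LSigma L).Term (Empty ⊕ Fin n)))) ='
      Term.func ((LHom.sumInl : L →ᴸ LSigma L).onFunction f)
        (fun i => sigmaTerm (Term.var (Sum.inr i) : (LSigma L).Term (Empty ⊕ Fin n))))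

/-- `∀ x, r(x) ↔ r(σ(x))`, for a relation symbol `r` of `L`. -/
def sigmaPreserves {L : FirstOrder.Language.{u, v}} {n : ℕ} (r : L.Relations n) : (LSigma L).Sentence :=
  BoundedFormula.alls
    ((Relations.boundedFormula ((LHom.sumInl : L →ᴸ LSigma L).onRelation r)
        (fun i => (Term.var (Sum.inr i) : (LSigma L).Term (Empty ⊕ Fin n)))).iff
      (Relations.boundedFormula ((LHom.sumInl : L →ᴸ LSigma L).onRelation r)
        (fun i => sigmaTerm (Term.var (Sum.inr i) : (LSigma L).Term (Empty ⊕ Fin n)))))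

/-- The `L_σ`-theory `T_σ`: the axioms of `T`, together with axioms expressing that `σ` is an
`L`-automorphism. -/
def TSigma {L : FirstOrder.Language.{u, v}} (T : L.Theory) : (LSigma L).Theory :=
  LHom.sumInl.onTheory T ∪ {sigmaInjective L, sigmaSurjective L} ∪
    {s | ∃ (n : ℕ) (f : L.Functions n), s = sigmaCommutes f} ∪
    {s | ∃ (n : ℕ) (r : L.Relations n), s = sigmaPreserves r}

/-! ## Types over models -/

section Types

variable {L : FirstOrder.Language.{u, v}} {T : L.Theory}

/-- `S_n(M)`, the set of complete `n`-types over the model `M`. -/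
abbrev TypesOver (M : ModelOf T) (n : ℕ) := (L.elementaryDiagram M).CompleteType (Fin n)

/-- The formula `ψ(x, b)` with parameters `b` in `M`, where `ψ(x, z)` is an `L`-formula. -/
def withParams (M : ModelOf T) {n k : ℕ} (ψ : L.Formula (Fin n ⊕ Fin k)) (b : Fin k → M) :
    L[[M]].Formula (Fin n) :=
  BoundedFormula.constantsVarsEquiv.symm
    (Formula.relabel (Sum.elim Sum.inr (fun j => Sum.inl (b j))) ψ)

/-- `ψ(x, b) ∈ p`. -/
def InType {M : ModelOf T} {n k : ℕ} (p : TypesOver M n) (ψ : L.Formula (Fin n ⊕ Fin k))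
    (b : Fin k → M) : Prop :=
  Formula.equivSentence (withParams M ψ b) ∈ p

/-- `ψ(x, b) ≠ ∅`. -/
def NonemptyIn (M : ModelOf T) {n k : ℕ} (ψ : L.Formula (Fin n ⊕ Fin k)) (b : Fin k → M) : Prop :=
  ∃ a : Fin n → M, ψ.Realize (Sum.elim a b)

/-- `⊨ ψ(x, b) → φ(x₁, c)`, where `x₁` is the subtuple of `x` given by `f`, that is, the tuple of
the variables `x_{f(i)}`. -/
def Implies (M : ModelOf T) {n n₁ k k₁ : ℕ} (f : Fin n₁ → Fin n)
    (ψ : L.Formula (Fin n ⊕ Fin k)) (b : Fin k → M)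
    (φ : L.Formula (Fin n₁ ⊕ Fin k₁)) (c : Fin k₁ → M) : Prop :=
  ∀ a : Fin n → M, ψ.Realize (Sum.elim a b) → φ.Realize (Sum.elim (fun i => a (f i)) c)

/-- `π(p) = p₁`, where `π` is the projection to the coordinates of the subtuple given by `f`. -/
def ProjectsTo {M : ModelOf T} {n n₁ : ℕ} (f : Fin n₁ → Fin n) (p : TypesOver M n)
    (p₁ : TypesOver M n₁) : Prop :=
  ∀ (k : ℕ) (φ : L.Formula (Fin n₁ ⊕ Fin k)) (b : Fin k → M),
    InType p₁ φ b ↔ InType p (Formula.relabel (Sum.map f id) φ) b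

/-- For an elementary map `j : M → N`, the type `q ∈ S(N)` restricts to `p ∈ S(M)` along `j`. If `j`
is an isomorphism this says that `q = j(p)`. -/
def RestrictsTo {M N : ModelOf T} (j : M ↪ₑ[L] N) {n : ℕ} (q : TypesOver N n) (p : TypesOver M n) :
    Prop :=
  ∀ (k : ℕ) (φ : L.Formula (Fin n ⊕ Fin k)) (b : Fin k → M),
    InType p φ b ↔ InType q φ (fun i => j (b i))

end Types

/-! ## Geometric notions of genericity -/

section Genericity

variable {L : FirstOrder.Language.{u, v}}

/-- A relation on pairs `(p, φ(x, b))`, where `p` is a finitary type over a model `M` of `T` and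
`φ(x, b) ∈ p` is a formula with parameters `b` in `M`. -/
structure GenericityRelation (T : L.Theory) where
  /-- `p` is generic in `φ(x, b)`. -/
  Generic : ∀ {M : ModelOf T} {n k : ℕ},
    TypesOver M n → L.Formula (Fin n ⊕ Fin k) → (Fin k → M) → Prop
  inType_of_generic : ∀ {M : ModelOf T} {n k : ℕ} {p : TypesOver M n}
    {φ : L.Formula (Fin n ⊕ Fin k)} {b : Fin k → M}, Generic p φ b → InType p φ b

variable {T : L.Theory} (R : GenericityRelation T)

/-- The formula `ψ(x, z)` is nice: for all models `M` and `b` in `M` with `ψ(x, b) ≠ ∅` there is a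
unique type over `M` which is generic in `ψ(x, b)`. -/
def NiceFormula {n k : ℕ} (ψ : L.Formula (Fin n ⊕ Fin k)) : Prop :=
  ∀ (M : ModelOf T) (b : Fin k → M), NonemptyIn M ψ b → ∃! p : TypesOver M n, R.Generic p ψ b

/-- The type `p` over `M` is nice: every formula of `p` is implied by some formula of
`N(p) = {ψ(x, b) nice | p is generic in ψ(x, b)}`. -/
def NiceType {M : ModelOf T} {n : ℕ} (p : TypesOver M n) : Prop :=
  ∀ (l : ℕ) (χ : L.Formula (Fin n ⊕ Fin l)) (c : Fin l → M), InType p χ c →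
    ∃ (k : ℕ) (ψ : L.Formula (Fin n ⊕ Fin k)) (b : Fin k → M),
      NiceFormula R ψ ∧ R.Generic p ψ b ∧ Implies M id ψ b χ c

/-- `θ(z, z₁)` ensures, in all models of `T`, that `ψ(x, z) ≠ ∅`, that `ψ(x, z)` implies
`φ(x₁, z₁)`, and that the generic type of `ψ(x, z)` projects onto the generic type of `φ(x₁, z₁)`.
Here `x₁` is the subtuple of `x` given by `f`. -/
def DefinesProjection {n n₁ k k₁ : ℕ} (f : Fin n₁ → Fin n)
    (ψ : L.Formula (Fin n ⊕ Fin k)) (φ : L.Formula (Fin n₁ ⊕ Fin k₁))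
    (θ : L.Formula (Fin k ⊕ Fin k₁)) : Prop :=
  ∀ (M : ModelOf T) (b : Fin k → M) (b₁ : Fin k₁ → M), θ.Realize (Sum.elim b b₁) →
    NonemptyIn M ψ b ∧ Implies M f ψ b φ b₁ ∧
      ∀ (p : TypesOver M n) (p₁ : TypesOver M n₁),
        R.Generic p ψ b → R.Generic p₁ φ b₁ → ProjectsTo f p p₁

/-- Geometric notions of genericity. -/
structure IsGeometric : Prop where
  /-- Invariance under automorphisms (of a monster model; equivalently, as `T` is complete, under
  isomorphisms between models). -/
  invariance : ∀ (M N : ModelOf T) (e : M ≃[L] N) (n k : ℕ) (p : TypesOver M n) (q : TypesOver N n)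
    (φ : L.Formula (Fin n ⊕ Fin k)) (b : Fin k → M),
    RestrictsTo e.toElementaryEmbedding q p →
      (R.Generic p φ b ↔ R.Generic q φ (fun i => e (b i)))
  /-- Coherence: the generic type of a nice formula over an elementary extension `N` of `M` restricts
  to its generic type over `M`. -/
  coherence : ∀ (M N : ModelOf T) (j : M ↪ₑ[L] N) (n k : ℕ) (φ : L.Formula (Fin n ⊕ Fin k))
    (b : Fin k → M) (p : TypesOver M n) (q : TypesOver N n),
    NiceFormula R φ → R.Generic p φ b → R.Generic q φ (fun i => j (b i)) → RestrictsTo j q p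
  /-- Enough nice types. -/
  enough_nice_types : ∀ (M : ModelOf T) (n : ℕ) (p₀ : TypesOver M n),
    ∃ (m : ℕ) (p : TypesOver M (n + m)), NiceType R p ∧ ProjectsTo (Fin.castAdd m) p p₀
  /-- Definability of generic projections. -/
  definability : ∀ (n n₁ k k₁ : ℕ) (f : Fin n₁ → Fin n), StrictMono f →
    ∀ (ψ : L.Formula (Fin n ⊕ Fin k)) (φ : L.Formula (Fin n₁ ⊕ Fin k₁)),
    NiceFormula R ψ → NiceFormula R φ →
    ∀ (M : ModelOf T) (b : Fin k → M) (b₁ : Fin k₁ → M) (p : TypesOver M n) (p₁ : TypesOver M n₁),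
    R.Generic p ψ b → R.Generic p₁ φ b₁ → Implies M f ψ b φ b₁ → ProjectsTo f p p₁ →
    ∃ θ : L.Formula (Fin k ⊕ Fin k₁), θ.Realize (Sum.elim b b₁) ∧ DefinesProjection R f ψ φ θ

/-! ## The geometric axioms -/

/-- The position of the subtuple `x` in `(x, x', x_r)`. -/
def fstBlock (n r : ℕ) (i : Fin n) : Fin (n + n + r) := Fin.castAdd r (Fin.castAdd n i)

/-- The position of the subtuple `x'` in `(x, x', x_r)`. -/
def sndBlock (n r : ℕ) (i : Fin n) : Fin (n + n + r) := Fin.castAdd r (Fin.natAdd n i)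

/-- The `L_σ`-sentence `∀ z̃ z, ∃ x x_r, θ(z̃, z) ∧ θ'(z̃, σ(z)) → ψ(x, σ(x), x_r, z̃)`. The variables
`z̃`, `z`, `x`, `x_r` are indexed by the four summands of `(Fin l ⊕ Fin k) ⊕ (Fin n ⊕ Fin r)`. -/
def geometricAxiom {n r l k : ℕ} (ψ : L.Formula (Fin (n + n + r) ⊕ Fin l))
    (θ θ' : L.Formula (Fin l ⊕ Fin k)) : (LSigma L).Sentence :=
  let V := (Fin l ⊕ Fin k) ⊕ (Fin n ⊕ Fin r)
  let zt : Fin l → (LSigma L).Term V := fun i => Term.var (Sum.inl (Sum.inl i))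
  let z : Fin k → (LSigma L).Term V := fun i => Term.var (Sum.inl (Sum.inr i))
  let x : Fin n → (LSigma L).Term V := fun i => Term.var (Sum.inr (Sum.inl i))
  let xr : Fin r → (LSigma L).Term V := fun i => Term.var (Sum.inr (Sum.inr i))
  let Θ : (LSigma L).Formula V :=
    BoundedFormula.subst (LHom.sumInl.onFormula θ) (Sum.elim zt z) ⊓
      BoundedFormula.subst (LHom.sumInl.onFormula θ') (Sum.elim zt (fun i => sigmaTerm (z i)))
  let Ψ : (LSigma L).Formula V :=
    BoundedFormula.subst (LHom.sumInl.onFormula ψ)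
      (Sum.elim (Fin.append (Fin.append x (fun i => sigmaTerm (x i))) xr) zt)
  Formula.iAlls (α := Empty) (Fin l ⊕ Fin k)
    (Formula.relabel Sum.inr (Formula.iExs (Fin n ⊕ Fin r) (Θ.imp Ψ)))

/-- The set of geometric axioms attached to a notion of genericity: for all `(M, σ) ⊨ T_σ`, all nice
types `p̃(x, x', x_r)`, `p(x)` and `p'(x')` over `M` such that `p̃` restricts to `p` and `p'` and
`p' = σ(p)`, all `ψ(x, x', x_r, b̃) ∈ N(p̃)` and `φ(x, b) ∈ N(p)` such that `ψ(x, x', x_r, b̃)` implies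
`φ(x, b) ∧ φ(x', σ(b))`, and all formulas `θ(z̃, z) ∈ tp(b̃, b)` and `θ'(z̃, z') ∈ tp(b̃, σ(b))` which
witness definability of generic projections for `ψ` and `φ(x, z)`, and for `ψ` and `φ(x', z')`,
respectively, the sentence `geometricAxiom ψ θ θ'`. -/
def geometricAxioms : (LSigma L).Theory :=
  {s | ∃ (M : ModelOf T) (σ : M ≃[L] M) (n r l k : ℕ)
      (pt : TypesOver M (n + n + r)) (p p' : TypesOver M n)
      (ψ : L.Formula (Fin (n + n + r) ⊕ Fin l)) (bt : Fin l → M)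
      (φ : L.Formula (Fin n ⊕ Fin k)) (b : Fin k → M)
      (θ θ' : L.Formula (Fin l ⊕ Fin k)),
      NiceType R pt ∧ NiceType R p ∧ NiceType R p' ∧
      ProjectsTo (fstBlock n r) pt p ∧ ProjectsTo (sndBlock n r) pt p' ∧
      RestrictsTo σ.toElementaryEmbedding p' p ∧
      NiceFormula R ψ ∧ R.Generic pt ψ bt ∧
      NiceFormula R φ ∧ R.Generic p φ b ∧
      Implies M (fstBlock n r) ψ bt φ b ∧
      Implies M (sndBlock n r) ψ bt φ (fun i => σ (b i)) ∧
      θ.Realize (Sum.elim bt b) ∧ DefinesProjection R (fstBlock n r) ψ φ θ ∧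
      θ'.Realize (Sum.elim bt (fun i => σ (b i))) ∧ DefinesProjection R (sndBlock n r) ψ φ θ' ∧
      s = geometricAxiom ψ θ θ'}

end Genericity

end

end GenericAutomorphism

-- Only two things need proof, since a model of TA is already a model of $T_\sigma$: every
-- $(M,\sigma)\models T_\sigma$ extends to a model of TA, and TA is model-complete.
-- Model-completeness of $T$ makes every embedding of models of $T_\sigma$ elementary for $L$.
--
-- Existence. Suppose $\theta(\tilde b,b)$ and $\theta'(\tilde b,\sigma(b))$ hold in $(M,\sigma)$.
-- The generic type $\tilde p$ of $\psi(\cdot,\tilde b)$ then projects onto the generic types $p$ of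
-- $\varphi(x,b)$ and $p'$ of $\varphi(x',\sigma(b))$. By invariance $\sigma(p)$ is also generic in
-- $\varphi(x',\sigma(b))$, so $\sigma(p)=p'$ by uniqueness. If $(a,a',a_r)$ realises $\tilde p$,
-- then $\sigma\cup\{a\mapsto a'\}$ is a partial elementary map and extends to an automorphism of a
-- larger model, where $(a,a',a_r)$ solves the axiom (`exists_solution`). Compactness solves all
-- instances over $M$ at once (`exists_solvesOver`), and the union of a chain of length $\omega$
-- satisfies TA.
--
-- Model-completeness. Let $M\subseteq N$ be models of TA. Any $\chi(a,\sigma(a),m)$ true in $N$,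
-- with $m$ in $M$, must have a solution in $M$ (`exists_solution_of_extension`). After extending
-- $N$, enlarge $a$ to a tuple $c$ with nice type $p$ over $M$; then $\sigma(c)$ has type
-- $\sigma(p)$. Extend the type of $(c,\sigma(c))$ to a nice $\tilde p$, and choose $\varphi\in
-- N(p)$ and $\psi\in N(\tilde p)$ implying $\varphi(x,b)\wedge\varphi(x',\sigma(b))\wedge\chi$.
-- Definability supplies $\theta,\theta'$, and the axiom gives a point of $\psi$ in $M$ of the form
-- $(x,\sigma(x),x_r)$. By compactness $N$ embeds over $M$ into an elementary extension of $M$, and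
-- Robinson's test applies.

universe w w' x

namespace GenericAutomorphism

/-! ### Compactness, elementary amalgamation and unions of chains -/

section ModelTheory

variable {L : FirstOrder.Language.{u, v}}

/-- Compactness for a set of formulas closed under conjunction. -/
theorem exists_realize_of_inf_closed {β : Type w} (Φ : Set (L.Formula β)) (hne : Φ.Nonempty)
    (hinf : ∀ φ ∈ Φ, ∀ ψ ∈ Φ, φ ⊓ ψ ∈ Φ)
    (hsat : ∀ φ ∈ Φ, ∃ (N : Type w') (_ : L.Structure N) (_ : Nonempty N) (c : β → N),
      φ.Realize c) :
    ∃ (N : Type (max u v w)) (_ : L.Structure N) (_ : Nonempty N) (c : β → N),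
      ∀ φ ∈ Φ, φ.Realize c := by
  classical
  have hfin : Theory.IsFinitelySatisfiable (Formula.equivSentence '' Φ) := by
    intro S hS
    -- Closure under conjunction lets a single member of `Φ` imply any given finite part.
    have key : ∃ χ ∈ Φ, ∀ (N : Type w') (_ : L.Structure N) (c : β → N), χ.Realize c →
        ∀ s ∈ S, (Formula.equivSentence.symm s).Realize c := by
      induction S using Finset.induction_on with
      | empty => exact ⟨_, hne.some_mem, by simp⟩
      | insert s S _ ih =>
        rw [Finset.coe_insert, Set.insert_subset_iff] at hS
        obtain ⟨χ, hχ, h⟩ := ih hS.2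
        obtain ⟨ψ, hψ, rfl⟩ := hS.1
        refine ⟨χ ⊓ ψ, hinf _ hχ _ hψ, fun N _ c hc => ?_⟩
        rw [Formula.realize_inf] at hc
        simp only [Finset.mem_insert, forall_eq_or_imp, Equiv.symm_apply_apply]
        exact ⟨hc.2, h N _ c hc.1⟩
    obtain ⟨χ, hχ, h⟩ := key
    obtain ⟨N, _, _, c, hc⟩ := hsat χ hχ
    let _ : (constantsOn β).Structure N := constantsOn.structure c
    have : N ⊨ (S : L[[β]].Theory) :=
      ⟨fun s hs => (Formula.realize_equivSentence_symm _ s c).1 (h N _ c hc s hs)⟩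
    exact Theory.Model.isSatisfiable N
  obtain ⟨N⟩ := Theory.isSatisfiable_iff_isFinitelySatisfiable.2 hfin
  let _ : L.Structure N := (L.lhomWithConstants β).reduct N
  refine ⟨N, inferInstance, inferInstance, fun b => (L.con b : N), fun φ hφ => ?_⟩
  have := Theory.realize_sentence_of_mem (M := N) _ (Set.mem_image_of_mem Formula.equivSentence hφ)
  exact (Formula.realize_equivSentence N φ).1 this

/-- A directed set of formulas with parameters in `A`, each satisfiable in `A`, is satisfiable in an
elementary extension of `A`. -/
theorem exists_elementary_extension (A : Type (max u v)) [L.Structure A] [Nonempty A]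
    {β : Type (max u v)} (Φ : Set (L.Formula (A ⊕ β)))
    (hdir : ∀ φ ∈ Φ, ∀ ψ ∈ Φ, ∃ χ ∈ Φ, ∀ c : β → A, χ.Realize (Sum.elim id c) →
      φ.Realize (Sum.elim id c) ∧ ψ.Realize (Sum.elim id c))
    (hsat : ∀ φ ∈ Φ, ∃ c : β → A, φ.Realize (Sum.elim id c)) (hne : Φ.Nonempty) :
    ∃ (N : Type (max u v)) (_ : L.Structure N) (_ : Nonempty N) (j : A ↪ₑ[L] N) (c : β → N),
      ∀ φ ∈ Φ, φ.Realize (Sum.elim j c) := by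
  -- `Φ` is enlarged to all formulas that follow in `A` from one of its members. By directedness
  -- this set is closed under conjunction, and it contains the elementary diagram of `A`, so its
  -- realisation is an elementary extension.
  obtain ⟨N, _, _, c, hc⟩ := exists_realize_of_inf_closed
    {φ : L.Formula (A ⊕ β) | ∃ χ ∈ Φ, ∀ c : β → A, χ.Realize (Sum.elim id c) →
      φ.Realize (Sum.elim id c)}
    (by obtain ⟨φ, hφ⟩ := hne; exact ⟨φ, φ, hφ, fun _ => id⟩)
    (by
      rintro φ ⟨χ, hχ, h⟩ φ' ⟨χ', hχ', h'⟩
      obtain ⟨ρ, hρ, hh⟩ := hdir χ hχ χ' hχ'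
      refine ⟨ρ, hρ, fun c hc => ?_⟩
      rw [Formula.realize_inf]
      exact ⟨h c (hh c hc).1, h' c (hh c hc).2⟩)
    (by
      rintro φ ⟨χ, hχ, h⟩
      obtain ⟨c, hc⟩ := hsat χ hχ
      exact ⟨A, _, inferInstance, _, h c hc⟩)
  have hpos : ∀ φ : L.Formula A, φ.Realize id → φ.Realize (c ∘ Sum.inl) := by
    intro φ hφ
    obtain ⟨χ, hχ⟩ := hne
    have := hc (φ.relabel Sum.inl) ⟨χ, hχ, fun c _ => by
      rw [Formula.realize_relabel, Sum.elim_comp_inl]; exact hφ⟩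
    rwa [Formula.realize_relabel] at this
  have hiff : ∀ φ : L.Formula A, φ.Realize (c ∘ Sum.inl) ↔ φ.Realize id := by
    intro φ
    refine ⟨fun h => ?_, hpos φ⟩
    by_contra hn
    exact (hpos φ.not (by rwa [Formula.realize_not])) h
  refine ⟨N, inferInstance, inferInstance, ⟨c ∘ Sum.inl, fun n φ x => ?_⟩, c ∘ Sum.inr,
    fun φ hφ => ?_⟩
  · have := hiff (φ.relabel x)
    rwa [Formula.realize_relabel, Formula.realize_relabel] at this
  · have := hc φ ⟨φ, hφ, fun _ => id⟩
    convert this using 1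
    exact Sum.elim_comp_inl_inr c

/-- Only finitely many of the variables in the second block occur in a formula. -/
theorem exists_finite_block {γ : Type w} {β : Type w'} (χ : L.Formula (γ ⊕ β)) :
    ∃ (k : ℕ) (b : Fin k → β) (χ' : L.Formula (γ ⊕ Fin k)), Function.Injective b ∧
      ∀ (N : Type x) [L.Structure N] (v : γ → N) (c : β → N),
        χ.Realize (Sum.elim v c) ↔ χ'.Realize (Sum.elim v (c ∘ b)) := by
  classical
  let S : Finset β := χ.freeVarFinset.toRight
  let e := S.equivFin
  let f : χ.freeVarFinset → γ ⊕ Fin S.card := fun y =>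
    match y with
    | ⟨Sum.inl g, _⟩ => Sum.inl g
    | ⟨Sum.inr b, h⟩ => Sum.inr (e ⟨b, Finset.mem_toRight.2 h⟩)
  refine ⟨S.card, fun i => (e.symm i : β), χ.restrictFreeVar f,
    Subtype.val_injective.comp e.symm.injective, fun N _ v c => ?_⟩
  refine (BoundedFormula.realize_restrictFreeVar (φ := χ) (f := f) (Sum.elim v c) ?_).symm
  rintro ⟨y | y, hy⟩
  · rfl
  · simp [f]

/-- Elementary amalgamation over a common family of elements. -/
theorem exists_amalgam {γ : Type w} (A B : Type (max u v)) [L.Structure A] [L.Structure B]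
    [Nonempty A] (a : γ → A) (b : γ → B)
    (h : ∀ φ : L.Formula γ, φ.Realize a ↔ φ.Realize b) :
    ∃ (K : Type (max u v)) (_ : L.Structure K) (_ : Nonempty K) (f : A ↪ₑ[L] K) (g : B ↪ₑ[L] K),
      ∀ i, f (a i) = g (b i) := by
  -- The formulas are the diagram of `B` with `b` replaced by `a`. Quantifying away the finitely
  -- many other elements of `B` leaves a formula true of `b`, hence of `a`, so each is satisfiable
  -- in `A`.
  obtain ⟨K, _, _, f, c, hc⟩ := exists_elementary_extension A (β := B)
    {χ | ∃ φ : L.Formula (γ ⊕ B), φ.Realize (Sum.elim b id) ∧ χ = φ.relabel (Sum.map a id)}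
    (by
      rintro _ ⟨φ, hφ, rfl⟩ _ ⟨ψ, hψ, rfl⟩
      refine ⟨_, ⟨φ ⊓ ψ, ?_, rfl⟩, fun c hc => ?_⟩
      · rw [Formula.realize_inf]; exact ⟨hφ, hψ⟩
      · rw [Formula.realize_relabel, Formula.realize_inf] at hc
        rwa [Formula.realize_relabel, Formula.realize_relabel])
    (by
      rintro _ ⟨φ, hφ, rfl⟩
      obtain ⟨k, d, φ', hd, hφ'⟩ := exists_finite_block.{u, v, w, max u v, max u v} φ
      have : (φ'.iExs (Fin k)).Realize a := by
        rw [h, Formula.realize_iExs]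
        exact ⟨_, (hφ' B b id).1 hφ⟩
      rw [Formula.realize_iExs] at this
      obtain ⟨y, hy⟩ := this
      refine ⟨Function.extend d y (fun _ => Classical.arbitrary A), ?_⟩
      rw [Formula.realize_relabel, Sum.elim_comp_map, Function.id_comp, Function.comp_id, hφ',
        Function.extend_comp hd]
      exact hy)
    ⟨_, ⊤, by simp, rfl⟩
  have hc' : ∀ φ : L.Formula (γ ⊕ B), φ.Realize (Sum.elim b id) →
      φ.Realize (Sum.elim (f ∘ a) c) := by
    intro φ hφ
    have := hc _ ⟨φ, hφ, rfl⟩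
    rwa [Formula.realize_relabel, Sum.elim_comp_map, Function.comp_id] at this
  have hiff : ∀ φ : L.Formula (γ ⊕ B), φ.Realize (Sum.elim (f ∘ a) c) ↔
      φ.Realize (Sum.elim b id) := by
    intro φ
    refine ⟨fun h => ?_, hc' φ⟩
    by_contra hn
    exact (hc' φ.not (by rwa [Formula.realize_not])) h
  refine ⟨K, inferInstance, inferInstance, f, ⟨c, fun n φ x => ?_⟩, fun i => ?_⟩
  · have := hiff (φ.relabel (Sum.inr ∘ x))
    rwa [Formula.realize_relabel, Formula.realize_relabel] at this
  · exact hc' (Term.equal (Term.var (Sum.inl i)) (Term.var (Sum.inr (b i))))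
      (by simp [Formula.realize_equal])

/-- The union of an elementary chain. -/
theorem exists_elementary_limit (G : ℕ → Type w) [∀ n, L.Structure (G n)]
    (j : ∀ n, G n ↪ₑ[L] G (n + 1)) :
    ∃ (N : Type w) (_ : L.Structure N) (ι : ∀ n, G n ↪ₑ[L] N),
      (∀ n x, ι (n + 1) (j n x) = ι n x) ∧ ∀ y, ∃ n x, ι n x = y := by
  let f : ∀ m n, m ≤ n → G m ↪[L] G n := fun m n h =>
    DirectedSystem.natLERec (fun n => (j n).toEmbedding) m n h
  let N := Language.DirectLimit G f
  let ι : ∀ n, G n ↪[L] N := fun n => Language.DirectLimit.of L ℕ G f n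
  have hf : ∀ n x, f n (n + 1) n.le_succ x = j n x := by
    intro n x
    change DirectedSystem.natLERec (fun n => (j n).toEmbedding) n (n + 1) n.le_succ x = j n x
    rw [DirectedSystem.coe_natLERec]
    exact Nat.leRecOn_succ' _
  have hι : ∀ n x, ι (n + 1) (j n x) = ι n x := fun n x => by
    rw [← hf]; exact Language.DirectLimit.of_f
  have hex : ∀ y : N, ∃ n x, ι n x = y := fun y => Language.DirectLimit.exists_of y
  have hle : ∀ m n (h : m ≤ n) x, ι n (f m n h x) = ι m x := fun m n h x => Language.DirectLimit.of_f
  have hfel : ∀ m n (h : m ≤ n) {l : ℕ} (φ : L.BoundedFormula Empty l) (xs : Fin l → G m),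
      φ.Realize default (f m n h ∘ xs) ↔ φ.Realize default xs := by
    intro m n h l φ xs
    induction n, h using Nat.le_induction with
    | base =>
      have : f m m le_rfl ∘ xs = xs := by
        funext i
        exact DirectedSystem.map_self (f := fun i j h => f i j h) _
      rw [this]
    | succ n h ih =>
      have : f m (n + 1) (h.trans n.le_succ) ∘ xs = j n ∘ (f m n h ∘ xs) := by
        funext i
        simp only [Function.comp_apply]
        rw [← hf]
        exact (DirectedSystem.map_map (f := fun i j h => f i j h) _ _ _).symm
      rw [this, ← ih, ← (j n).map_boundedFormula, Unique.eq_default (j n ∘ default)]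
  -- Only the universal case uses the chain: an element of the union comes from some stage, and
  -- `hfel` carries the universal statement to a later stage containing both it and `xs`.
  have hel : ∀ {l : ℕ} (φ : L.BoundedFormula Empty l) (n : ℕ) (xs : Fin l → G n),
      φ.Realize default (ι n ∘ xs) ↔ φ.Realize default xs := by
    intro l φ
    induction φ with
    | falsum => intros; rfl
    | equal t₁ t₂ =>
      intro n xs
      rw [← Unique.eq_default (ι n ∘ default)]
      simp [BoundedFormula.Realize, ← Sum.comp_elim, HomClass.realize_term]
    | rel R ts =>
      intro n xs
      rw [← Unique.eq_default (ι n ∘ default)]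
      simp only [BoundedFormula.Realize, ← Sum.comp_elim, HomClass.realize_term]
      exact (ι n).map_rel R _
    | imp φ ψ h₁ h₂ => intro n xs; simp only [BoundedFormula.realize_imp, h₁, h₂]
    | all φ ih =>
      intro n xs
      simp only [BoundedFormula.realize_all]
      constructor
      · intro h x
        rw [← ih, Fin.comp_snoc]
        exact h _
      · intro h y
        obtain ⟨m, x, rfl⟩ := hex y
        have hn := (hfel n (max n m) (le_max_left _ _) φ.all xs).2 h
        rw [BoundedFormula.realize_all] at hn
        have := (ih (max n m) _).2 (hn (f m (max n m) (le_max_right _ _) x))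
        rw [Fin.comp_snoc, hle] at this
        convert this using 2
        funext i
        exact (hle n (max n m) (le_max_left _ _) (xs i)).symm
  refine ⟨N, inferInstance, fun n => ⟨ι n, fun l φ x => ?_⟩, hι, hex⟩
  exact φ.realize_relabel_sumInr.symm.trans ((hel _ n x).trans φ.realize_relabel_sumInr)

end ModelTheory

/-! ### Types over models and their realisations -/

section Types

variable {L : FirstOrder.Language.{u, v}} {T : L.Theory}

theorem realize_withParams {M : ModelOf T} {N : Type w} [L.Structure N] [L[[M]].Structure N]
    [(L.lhomWithConstants M).IsExpansionOn N] {n k : ℕ} (ψ : L.Formula (Fin n ⊕ Fin k))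
    (b : Fin k → M) (a : Fin n → N) :
    (withParams M ψ b).Realize a ↔
      ψ.Realize (Sum.elim a (fun i => ((L.con (b i) : L[[M]].Constants) : N))) := by
  rw [Formula.Realize, ← BoundedFormula.realize_constantsVarsEquiv, withParams,
    Equiv.apply_symm_apply]
  change (Formula.relabel _ ψ).Realize _ ↔ _
  rw [Formula.realize_relabel]
  congr! 1
  funext i
  rcases i with i | i <;> rfl

/-- `p` is the type over `M` of the tuple `a` of the elementary extension `j : M → N`. -/
def Realizes {M N : ModelOf T} (j : M ↪ₑ[L] N) {n : ℕ} (a : Fin n → N) (p : TypesOver M n) :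
    Prop :=
  ∀ (k : ℕ) (ψ : L.Formula (Fin n ⊕ Fin k)) (b : Fin k → M),
    InType p ψ b ↔ ψ.Realize (Sum.elim a (fun i => j (b i)))

/-- An `L`-structure into which a model of `T` embeds elementarily, as a model of `T`. -/
abbrev modelOfElementary {M : ModelOf T} {N : Type (max u v)} [L.Structure N] [Nonempty N]
    (j : M ↪ₑ[L] N) : ModelOf T :=
  have : N ⊨ T := (j.theory_model_iff T).1 M.is_model
  Theory.ModelType.of T N

theorem exists_realizes {M N : ModelOf T} (j : M ↪ₑ[L] N) {n : ℕ} (a : Fin n → N) :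
    ∃ p : TypesOver M n, Realizes j a p := by
  let _ : (constantsOn M).Structure N := constantsOn.structure j
  have key : ∀ s : L[[M]].Sentence, N ⊨ s ↔ M ⊨ s := by
    intro s
    rw [← Formula.realize_equivSentence_symm M s id,
      ← Formula.realize_equivSentence_symm N s j, ← j.map_formula, Function.comp_id]
  have : N ⊨ L.elementaryDiagram M := ⟨fun s hs => (key s).2 hs⟩
  refine ⟨(L.elementaryDiagram M).typeOf a, fun k ψ b => ?_⟩
  rw [InType, Theory.CompleteType.formula_mem_typeOf, realize_withParams]
  rfl

theorem exists_realization {M : ModelOf T} {n : ℕ} (p : TypesOver M n) :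
    ∃ (N : ModelOf T) (j : M ↪ₑ[L] N) (a : Fin n → N), Realizes j a p := by
  obtain ⟨N, hN⟩ := Theory.exists_modelType_is_realized_in _ p
  obtain ⟨a, rfl⟩ := hN
  let _ : L.Structure N := (L.lhomWithConstants M).reduct N
  let j : M ↪ₑ[L] N := ElementaryEmbedding.ofModelsElementaryDiagram L M N
  refine ⟨modelOfElementary j, j, a, fun k ψ b => ?_⟩
  rw [InType, Theory.CompleteType.formula_mem_typeOf, realize_withParams]
  rfl

theorem Realizes.projectsTo_iff {M N : ModelOf T} {j : M ↪ₑ[L] N} {n n₁ : ℕ} {a : Fin n → N}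
    {p : TypesOver M n} (h : Realizes j a p) (f : Fin n₁ → Fin n) (p₁ : TypesOver M n₁) :
    ProjectsTo f p p₁ ↔ Realizes j (a ∘ f) p₁ := by
  refine forall₃_congr fun k φ b => ?_
  rw [h k, Formula.realize_relabel, Sum.elim_comp_map, Function.comp_id]

theorem Realizes.projectsTo {M N : ModelOf T} {j : M ↪ₑ[L] N} {n n₁ : ℕ} {a : Fin n → N}
    {p : TypesOver M n} (h : Realizes j a p) {f : Fin n₁ → Fin n} {p₁ : TypesOver M n₁}
    (h₁ : Realizes j (a ∘ f) p₁) : ProjectsTo f p p₁ :=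
  (h.projectsTo_iff f p₁).2 h₁

theorem Realizes.restrictsTo {M N : ModelOf T} {j : M ↪ₑ[L] N} (σ : M ≃[L] M) {n : ℕ}
    {a a' : Fin n → N} {p p' : TypesOver M n} (h : Realizes j a p) (h' : Realizes j a' p')
    (haa' : ∀ (k : ℕ) (φ : L.Formula (Fin n ⊕ Fin k)) (b : Fin k → M),
      φ.Realize (Sum.elim a (fun i => j (b i))) ↔
        φ.Realize (Sum.elim a' (fun i => j (σ (b i))))) :
    RestrictsTo σ.toElementaryEmbedding p' p := fun k φ b =>
  (h k φ b).trans ((haa' k φ b).trans (h' k φ _).symm)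

/-- Two families which agree on formulas with finitely many parameters agree on all formulas. -/
theorem realize_iff_of_finite_blocks {α : Type w} {β : Type w'} {N N' : Type x} [L.Structure N]
    [L.Structure N'] {a : α → N} {a' : α → N'} {c : β → N} {c' : β → N'}
    (h : ∀ (k : ℕ) (φ : L.Formula (α ⊕ Fin k)) (b : Fin k → β),
      φ.Realize (Sum.elim a (c ∘ b)) ↔ φ.Realize (Sum.elim a' (c' ∘ b)))
    (φ : L.Formula (α ⊕ β)) :
    φ.Realize (Sum.elim a c) ↔ φ.Realize (Sum.elim a' c') := by
  obtain ⟨k, b, φ', -, hφ'⟩ := exists_finite_block.{u, v, w, w', x} φ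
  rw [hφ', hφ', h]

/-- The image of a type under an automorphism. -/
theorem exists_image_type {M : ModelOf T} (σ : M ≃[L] M) {n : ℕ} (p : TypesOver M n) :
    ∃ q : TypesOver M n, RestrictsTo σ.toElementaryEmbedding q p := by
  obtain ⟨N, j, a, h⟩ := exists_realization p
  -- The image type is the type of the same tuple, with `M` embedded through `j ∘ σ⁻¹`.
  obtain ⟨q, hq⟩ := exists_realizes (j.comp σ.symm.toElementaryEmbedding) a
  refine ⟨q, fun k φ b => ?_⟩
  rw [h k, hq k]
  simp

end Types

/-! ### Extending partial elementary maps to automorphisms -/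

section Automorphisms

variable {L : FirstOrder.Language.{u, v}} {T : L.Theory}

theorem ModelOf.exists_amalgam {γ : Type w} (A B : ModelOf T) (a : γ → A) (b : γ → B)
    (h : ∀ φ : L.Formula γ, φ.Realize a ↔ φ.Realize b) :
    ∃ (K : ModelOf T) (f : A ↪ₑ[L] K) (g : B ↪ₑ[L] K), ∀ i, f (a i) = g (b i) := by
  obtain ⟨K, _, _, f, g, hfg⟩ := GenericAutomorphism.exists_amalgam A B a b h
  exact ⟨modelOfElementary f, f, g, hfg⟩

/-- Finite tuples in the union of a chain already live at one stage; this is what makes formulas and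
axiom instances local. -/
theorem exists_common_level {G : ℕ → Type w} {N : Type w'} {j : ∀ n, G n → G (n + 1)}
    {ι : ∀ n, G n → N} (hι : ∀ n x, ι (n + 1) (j n x) = ι n x) (hex : ∀ y, ∃ n x, ι n x = y)
    {α : Type x} [Finite α] (y : α → N) : ∃ (n : ℕ) (z : α → G n), ∀ i, ι n (z i) = y i := by
  choose m x hx using fun i => hex (y i)
  have := Fintype.ofFinite α
  have hup : ∀ n k, n ≤ k → ∀ z : G n, ∃ z' : G k, ι k z' = ι n z := by
    intro n k h z
    induction k, h using Nat.le_induction with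
    | base => exact ⟨z, rfl⟩
    | succ k h ih =>
      obtain ⟨z', hz'⟩ := ih
      exact ⟨j k z', by rw [hι, hz']⟩
  choose z hz using fun i => hup (m i) (Finset.univ.sup m) (Finset.le_sup (Finset.mem_univ i)) (x i)
  exact ⟨_, z, fun i => by rw [hz, hx]⟩

/-- The union of an elementary chain of models, with the map induced by a compatible sequence of
elementary maps. -/
theorem ModelOf.exists_limit (G : ℕ → ModelOf T) (j e : ∀ n, G n ↪ₑ[L] G (n + 1))
    (h : ∀ n x, e (n + 1) (j n x) = j (n + 1) (e n x)) :
    ∃ (N : ModelOf T) (ι : ∀ n, G n ↪ₑ[L] N) (E : N ↪ₑ[L] N),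
      (∀ n x, ι (n + 1) (j n x) = ι n x) ∧ (∀ y, ∃ n x, ι n x = y) ∧
      ∀ n x, E (ι n x) = ι (n + 1) (e n x) := by
  obtain ⟨N, _, ι, hι, hex⟩ := exists_elementary_limit (L := L) (fun n => (G n : Type _)) j
  have : Nonempty N := (inferInstance : Nonempty (G 0)).map (ι 0)
  choose m z hz using hex
  -- The stage representing a point is not unique. Compatibility of `e` with `j` makes the induced
  -- map independent of it.
  have hwd : ∀ n n', n ≤ n' → ∀ (x : G n) (x' : G n'), ι n x = ι n' x' →
      ι (n + 1) (e n x) = ι (n' + 1) (e n' x') := by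
    intro n n' hn x x' hx
    induction n', hn using Nat.le_induction with
    | base => rw [(ι n).injective hx]
    | succ k hk ih =>
      obtain ⟨y, hy⟩ : ∃ y : G k, ι k y = ι n x := by
        clear ih hx x'
        induction k, hk using Nat.le_induction with
        | base => exact ⟨x, rfl⟩
        | succ k _ ih =>
          obtain ⟨y, hy⟩ := ih
          exact ⟨j k y, by rw [hι, hy]⟩
      have hyx : j k y = x' := (ι (k + 1)).injective (by rw [hι, hy, hx])
      rw [ih y hy.symm, ← hyx, h, hι]
  have hwd' : ∀ n n' (x : G n) (x' : G n'), ι n x = ι n' x' →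
      ι (n + 1) (e n x) = ι (n' + 1) (e n' x') := by
    intro n n' x x' hx
    rcases le_total n n' with hn | hn
    · exact hwd n n' hn x x' hx
    · exact (hwd n' n hn x' x hx.symm).symm
  let F : N → N := fun y => ι (m y + 1) (e (m y) (z y))
  have hF : ∀ n x, F (ι n x) = ι (n + 1) (e n x) := fun n x => hwd' _ _ _ _ (hz _)
  let E : N ↪ₑ[L] N := ⟨F, fun l φ y => by
    obtain ⟨n, y, hy⟩ := exists_common_level (G := fun n => G n)
      (j := fun n => j n) (ι := fun n => ι n) hι (fun y => ⟨m y, z y, hz y⟩) y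
    obtain rfl : (ι n ∘ y) = _ := funext hy
    have : F ∘ (ι n ∘ y) = ((ι (n + 1)).comp (e n)) ∘ y := funext fun i => hF n (y i)
    rw [this, ElementaryEmbedding.map_formula, ElementaryEmbedding.map_formula]⟩
  exact ⟨modelOfElementary (ι 0), ι, E, hι, fun y => ⟨m y, z y, hz y⟩, hF⟩

/-- A surjective elementary self-map as an automorphism. -/
noncomputable def equivOfSurjective {N : Type w} [L.Structure N] (E : N ↪ₑ[L] N)
    (h : Function.Surjective E) : N ≃[L] N where
  toEquiv := Equiv.ofBijective E ⟨E.injective, h⟩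
  map_fun' := E.map_fun
  map_rel' := E.map_rel

/-- An elementary self-map of a model extends to an automorphism of an elementary extension. -/
theorem exists_automorphism_of_endomorphism (N : ModelOf T) (E : N ↪ₑ[L] N) :
    ∃ (K : ModelOf T) (τ : K ≃[L] K) (q : N ↪ₑ[L] K), ∀ x, τ (q x) = q (E x) := by
  -- In the limit of `N → N → ⋯` along `E`, the point `x` at stage `n` is `E x` at stage `n + 1`, so
  -- `x` at stage `n + 1` is its preimage under the map induced by `E`. The `E.comp E` accounts for
  -- the shift of one stage.
  obtain ⟨K, ι, F, hι, hex, hF⟩ := ModelOf.exists_limit (fun _ => N) (fun _ => E)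
    (fun _ => E.comp E) (fun _ _ => rfl)
  have hF' : ∀ n x, F (ι n x) = ι n (E x) := fun n x => by
    rw [hF, ← hι n (E x)]; rfl
  refine ⟨K, equivOfSurjective F fun y => ?_, ι 0, hF' 0⟩
  obtain ⟨n, x, rfl⟩ := hex y
  exact ⟨ι (n + 1) x, by rw [hF', hι]⟩

/-- A pair of elementary embeddings with the same source and target. -/
structure ParallelPair (T : L.Theory) where
  /-- The common source. -/
  source : ModelOf T
  /-- The common target. -/
  target : ModelOf T
  /-- The first map, thought of as an inclusion. -/
  incl : source ↪ₑ[L] target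
  /-- The second map. -/
  map : source ↪ₑ[L] target

/-- The target is amalgamated with itself over the source, embedded once by `incl` and once by
`map`. -/
theorem ParallelPair.exists_next (P : ParallelPair T) :
    ∃ (K : ModelOf T) (j e : P.target ↪ₑ[L] K), ∀ x, e (P.incl x) = j (P.map x) := by
  obtain ⟨K, e, j, h⟩ := ModelOf.exists_amalgam P.target P.target P.incl P.map fun φ => by
    rw [← Function.comp_id P.incl, ← Function.comp_id P.map, P.incl.map_formula, P.map.map_formula]
  exact ⟨K, j, e, h⟩

/-- The next pair in the chain obtained by iterated amalgamation. -/
noncomputable def ParallelPair.next (P : ParallelPair T) : ParallelPair T where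
  source := P.target
  target := P.exists_next.choose
  incl := P.exists_next.choose_spec.choose
  map := P.exists_next.choose_spec.choose_spec.choose

theorem ParallelPair.next_map_incl (P : ParallelPair T) (x : P.source) :
    P.next.map (P.incl x) = P.next.incl (P.map x) :=
  P.exists_next.choose_spec.choose_spec.choose_spec x

/-- The chain obtained by iterated amalgamation. -/
noncomputable def ParallelPair.chain (P : ParallelPair T) : ℕ → ParallelPair T
  | 0 => P
  | n + 1 => (P.chain n).next

/-- Two elementary embeddings `incl, map : A → B` become the restriction of an automorphism. -/
theorem ParallelPair.exists_automorphism (P : ParallelPair T) :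
    ∃ (K : ModelOf T) (τ : K ≃[L] K) (q : P.target ↪ₑ[L] K),
      ∀ x, τ (q (P.incl x)) = q (P.map x) := by
  obtain ⟨N, ι, E, hι, -, hE⟩ := ModelOf.exists_limit (fun n => (P.chain n).source)
    (fun n => (P.chain n).incl) (fun n => (P.chain n).map)
    (fun n x => (P.chain n).next_map_incl x)
  obtain ⟨K, τ, q, h⟩ := exists_automorphism_of_endomorphism N E
  -- The target of `P` is stage 1 of the chain, its source being stage 0.
  refine ⟨K, τ, q.comp (ι 1), fun x => ?_⟩
  change τ (q (ι 1 (P.incl x))) = q (ι 1 (P.map x))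
  rw [h]
  congr 1
  exact (congrArg E (hι 0 x)).trans (hE 0 x)

/-- Let `σ` be an automorphism of `M`, and let `a`, `a'` be families in an elementary extension `K`
of `M` such that the type of `a'` over `M` is the image under `σ` of the type of `a`. Then `σ` extends
to an automorphism of an elementary extension of `K` which maps `a` to `a'`. -/
theorem exists_automorphism_extension {α : Type w} {M K : ModelOf T} (σ : M ≃[L] M)
    (i : M ↪ₑ[L] K) (a a' : α → K)
    (h : ∀ φ : L.Formula (α ⊕ M),
      φ.Realize (Sum.elim a i) ↔ φ.Realize (Sum.elim a' (i ∘ σ))) :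
    ∃ (N : ModelOf T) (τ : N ≃[L] N) (q : K ↪ₑ[L] N),
      (∀ x, τ (q (i x)) = q (i (σ x))) ∧ ∀ l, τ (q (a l)) = q (a' l) := by
  -- Here `e ∘ i = j ∘ i ∘ σ` and `e ∘ a = j ∘ a'`. With `j` viewed as the inclusion, an
  -- automorphism extending `e` does what is required.
  obtain ⟨K', e, j, hej⟩ := ModelOf.exists_amalgam K K (Sum.elim a i) (Sum.elim a' (i ∘ σ)) h
  obtain ⟨N, τ, q, hq⟩ := ParallelPair.exists_automorphism ⟨K, K', j, e⟩
  exact ⟨N, τ, q.comp j, fun x => (hq _).trans (congrArg q (hej (Sum.inr x))),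
    fun l => (hq _).trans (congrArg q (hej (Sum.inl l)))⟩

end Automorphisms

/-! ### The language with σ and the meaning of the axioms -/

section Expansion

variable {L : FirstOrder.Language.{u, v}}

/-- The interpretation of `σ`. -/
def sigmaMap (L : FirstOrder.Language.{u, v}) {N : Type w} [(LSigma L).Structure N] (x : N) : N :=
  Structure.funMap ((LHom.sumInr : sigmaLanguage →ᴸ LSigma L).onFunction SigmaFunctions.sigma) ![x]

theorem funMap_sigma {N : Type w} [(LSigma L).Structure N] (x : Fin 1 → N) :
    Structure.funMap ((LHom.sumInr : sigmaLanguage →ᴸ LSigma L).onFunction SigmaFunctions.sigma) x =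
      sigmaMap L (x 0) := by
  rw [sigmaMap]
  congr 1
  funext i
  fin_cases i
  rfl

theorem realize_sigmaTerm {N : Type w} [(LSigma L).Structure N] {α : Type w'}
    (t : (LSigma L).Term α) (e : α → N) :
    (sigmaTerm t).realize e = sigmaMap L (t.realize e) :=
  Term.realize_functions_apply₁

theorem map_sigmaMap {A : Type w} {B : Type w'} [(LSigma L).Structure A] [(LSigma L).Structure B]
    (g : A ↪[LSigma L] B) (x : A) : g (sigmaMap L x) = sigmaMap L (g x) := by
  rw [sigmaMap, g.map_fun, funMap_sigma]
  rfl

/-- The terms `(x, σ(x), x_r, z̃)`. -/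
theorem realize_append_sigmaTerm {A : Type w} [(LSigma L).Structure A] {V : Type*} {n r l : ℕ}
    (x : Fin n → (LSigma L).Term V)
    (xr : Fin r → (LSigma L).Term V) (zt : Fin l → (LSigma L).Term V) (e : V → A) :
    (fun i => (Sum.elim (Fin.append (Fin.append x (fun i => sigmaTerm (x i))) xr) zt i).realize e) =
      Sum.elim (Fin.append (Fin.append (fun i => (x i).realize e)
        (fun i => sigmaMap L ((x i).realize e))) (fun i => (xr i).realize e))
        (fun i => (zt i).realize e) := by
  funext i
  rcases i with i | i
  · refine Fin.addCases (fun i => ?_) (fun i => ?_) i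
    · refine Fin.addCases (fun i => ?_) (fun i => ?_) i
      · simp
      · simp only [Sum.elim_inl, Fin.append_left, Fin.append_right]
        exact realize_sigmaTerm _ _
    · simp
  · rfl

variable {A : Type w} {B : Type w'} [(LSigma L).Structure A] [(LSigma L).Structure B]
  [L.Structure A] [L.Structure B] [(LHom.sumInl : L →ᴸ LSigma L).IsExpansionOn A]
  [(LHom.sumInl : L →ᴸ LSigma L).IsExpansionOn B]

/-- The `L`-embedding underlying an `L_σ`-embedding. -/
def reductEmbedding (g : A ↪[LSigma L] B) : A ↪[L] B where
  toEmbedding := g.toEmbedding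
  map_fun' f x := by
    have := g.map_fun ((LHom.sumInl : L →ᴸ LSigma L).onFunction f) x
    rwa [LHom.map_onFunction, LHom.map_onFunction] at this
  map_rel' r x := by
    have := g.map_rel ((LHom.sumInl : L →ᴸ LSigma L).onRelation r) x
    rwa [LHom.map_onRelation, LHom.map_onRelation] at this

/-- An `L`-embedding commuting with `σ`, as an `L_σ`-embedding. -/
def expandEmbedding (g : A ↪[L] B) (h : ∀ x, g (sigmaMap L x) = sigmaMap L (g x)) :
    A ↪[LSigma L] B where
  toEmbedding := g.toEmbedding
  map_fun' := by
    rintro n (f | f) x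
    · have := g.map_fun f x
      rwa [← LHom.map_onFunction (LHom.sumInl : L →ᴸ LSigma L),
        ← LHom.map_onFunction (LHom.sumInl : L →ᴸ LSigma L)] at this
    · cases f
      exact (congrArg g (funMap_sigma x)).trans ((h (x 0)).trans (funMap_sigma (g ∘ x)).symm)
  map_rel' := by
    rintro n (r | r) x
    · have := g.map_rel r x
      rwa [← LHom.map_onRelation (LHom.sumInl : L →ᴸ LSigma L),
        ← LHom.map_onRelation (LHom.sumInl : L →ᴸ LSigma L)] at this
    · cases r

/-- The expansion of an `L`-structure by the interpretation of `σ`. -/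
abbrev sigmaStructure {N : Type w} (σ : N → N) : sigmaLanguage.Structure N where
  funMap := fun {_} f x => match f with | SigmaFunctions.sigma => σ (x 0)
  RelMap := fun r _ => r.elim

theorem model_TSigma_iff (T : L.Theory) :
    A ⊨ TSigma T ↔ A ⊨ T ∧ Function.Bijective (sigmaMap L : A → A) ∧
      (∀ (n : ℕ) (f : L.Functions n) (x : Fin n → A),
        sigmaMap L (Structure.funMap f x) = Structure.funMap f (fun i => sigmaMap L (x i))) ∧
      (∀ (n : ℕ) (r : L.Relations n) (x : Fin n → A),
        Structure.RelMap r x ↔ Structure.RelMap r (fun i => sigmaMap L (x i))) := by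
  have hinj : A ⊨ sigmaInjective L ↔ Function.Injective (sigmaMap L : A → A) := by
    simp only [sigmaInjective, Sentence.Realize, Formula.Realize, BoundedFormula.realize_all,
      BoundedFormula.realize_imp, BoundedFormula.realize_bdEqual, realize_sigmaTerm]
    rfl
  have hsurj : A ⊨ sigmaSurjective L ↔ Function.Surjective (sigmaMap L : A → A) := by
    simp only [sigmaSurjective, Sentence.Realize, Formula.Realize, BoundedFormula.realize_all,
      BoundedFormula.realize_ex, BoundedFormula.realize_bdEqual, realize_sigmaTerm]
    rfl
  have hfun : ∀ (n : ℕ) (f : L.Functions n), A ⊨ sigmaCommutes f ↔ ∀ x : Fin n → A,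
      sigmaMap L (Structure.funMap f x) = Structure.funMap f (fun i => sigmaMap L (x i)) := by
    intro n f
    simp only [sigmaCommutes, Sentence.Realize, BoundedFormula.realize_alls,
      BoundedFormula.realize_bdEqual, realize_sigmaTerm, Term.realize_func, LHom.map_onFunction]
    rfl
  have hrel : ∀ (n : ℕ) (r : L.Relations n), A ⊨ sigmaPreserves r ↔ ∀ x : Fin n → A,
      (Structure.RelMap r x ↔ Structure.RelMap r (fun i => sigmaMap L (x i))) := by
    intro n r
    simp only [sigmaPreserves, Sentence.Realize, BoundedFormula.realize_alls,
      BoundedFormula.realize_iff, BoundedFormula.realize_rel, realize_sigmaTerm,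
      LHom.map_onRelation]
    rfl
  rw [TSigma, Theory.model_union_iff, Theory.model_union_iff, Theory.model_union_iff,
    LHom.onTheory_model, Theory.model_insert_iff, Theory.model_singleton_iff, hinj, hsurj,
    and_assoc, and_assoc, Function.Bijective]
  refine and_congr_right fun _ => and_congr_right fun _ => and_congr ?_ ?_
  · simp only [Theory.model_iff, Set.mem_ofPred_eq]
    exact ⟨fun h n f => (hfun n f).1 (h _ ⟨n, f, rfl⟩), by
      rintro h _ ⟨n, f, rfl⟩; exact (hfun n f).2 (h n f)⟩
  · simp only [Theory.model_iff, Set.mem_ofPred_eq]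
    exact ⟨fun h n f => (hrel n f).1 (h _ ⟨n, f, rfl⟩), by
      rintro h _ ⟨n, f, rfl⟩; exact (hrel n f).2 (h n f)⟩

/-- The property of `(N, σ)` expressed by the sentence `geometricAxiom ψ θ θ'`. -/
def SatisfiesAxiom {N : Type w} [L.Structure N] (σ : N → N) {n r l k : ℕ}
    (ψ : L.Formula (Fin (n + n + r) ⊕ Fin l)) (θ θ' : L.Formula (Fin l ⊕ Fin k)) : Prop :=
  ∀ (bt : Fin l → N) (b : Fin k → N), θ.Realize (Sum.elim bt b) →
    θ'.Realize (Sum.elim bt (fun i => σ (b i))) → ∃ (x : Fin n → N) (xr : Fin r → N),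
      ψ.Realize (Sum.elim (Fin.append (Fin.append x (fun i => σ (x i))) xr) bt)

/-- Substituting terms of `L_σ` into an `L`-formula. -/
theorem realize_subst_onFormula {α : Type*} {V : Type*} (φ : L.Formula α)
    (t : α → (LSigma L).Term V) (e : V → A) :
    Formula.Realize (BoundedFormula.subst (LHom.sumInl.onFormula φ) t) e ↔
      φ.Realize (fun i => (t i).realize e) := by
  rw [Formula.Realize, BoundedFormula.realize_subst]
  exact LHom.realize_onFormula _ φ

theorem realize_geometricAxiom [Nonempty A] {n r l k : ℕ}
    (ψ : L.Formula (Fin (n + n + r) ⊕ Fin l)) (θ θ' : L.Formula (Fin l ⊕ Fin k)) :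
    A ⊨ geometricAxiom ψ θ θ' ↔ SatisfiesAxiom (sigmaMap L : A → A) ψ θ θ' := by
  have h1 : ∀ (c : Fin l ⊕ Fin k → A) (d : Fin n ⊕ Fin r → A),
      (fun i => Term.realize (Sum.elim c d) (Sum.elim
        (fun i => (Term.var (Sum.inl (Sum.inl i)) :
          (LSigma L).Term ((Fin l ⊕ Fin k) ⊕ (Fin n ⊕ Fin r))))
        (fun i => Term.var (Sum.inl (Sum.inr i))) i)) =
      Sum.elim (fun i => c (Sum.inl i)) (fun i => c (Sum.inr i)) := by
    intro c d; funext i; rcases i with i | i <;> rfl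
  have h2 : ∀ (c : Fin l ⊕ Fin k → A) (d : Fin n ⊕ Fin r → A),
      (fun i => Term.realize (Sum.elim c d) (Sum.elim
        (fun i => (Term.var (Sum.inl (Sum.inl i)) :
          (LSigma L).Term ((Fin l ⊕ Fin k) ⊕ (Fin n ⊕ Fin r))))
        (fun i => sigmaTerm (Term.var (Sum.inl (Sum.inr i)))) i)) =
      Sum.elim (fun i => c (Sum.inl i)) (fun i => sigmaMap L (c (Sum.inr i))) := by
    intro c d; funext i; rcases i with i | i
    · rfl
    · exact realize_sigmaTerm _ _
  have step : A ⊨ geometricAxiom ψ θ θ' ↔ ∀ c : Fin l ⊕ Fin k → A, ∃ d : Fin n ⊕ Fin r → A,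
      (θ.Realize (Sum.elim (fun i => c (Sum.inl i)) (fun i => c (Sum.inr i))) ∧
        θ'.Realize (Sum.elim (fun i => c (Sum.inl i)) (fun i => sigmaMap L (c (Sum.inr i))))) →
      ψ.Realize (Sum.elim (Fin.append (Fin.append (fun i => d (Sum.inl i))
        (fun i => sigmaMap L (d (Sum.inl i)))) (fun i => d (Sum.inr i)))
        (fun i => c (Sum.inl i))) := by
    simp only [geometricAxiom, Sentence.Realize, Formula.realize_iAlls, Formula.realize_relabel,
      Formula.realize_iExs, Formula.realize_imp, Formula.realize_inf, realize_subst_onFormula,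
      Sum.elim_comp_inr, h1, h2, realize_append_sigmaTerm]
    rfl
  rw [step]
  constructor
  · intro h bt b hθ hθ'
    obtain ⟨d, hd⟩ := h (Sum.elim bt b)
    exact ⟨_, _, hd ⟨hθ, hθ'⟩⟩
  · intro h c
    by_cases hθ : θ.Realize (Sum.elim (fun i => c (Sum.inl i)) (fun i => c (Sum.inr i))) ∧
      θ'.Realize (Sum.elim (fun i => c (Sum.inl i)) (fun i => sigmaMap L (c (Sum.inr i))))
    · obtain ⟨x, xr, hx⟩ := h _ _ hθ.1 hθ.2
      exact ⟨Sum.elim x xr, fun _ => hx⟩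
    -- The existential quantifiers stand outside the implication, so a witness is due even when the
    -- premise fails; any point of the nonempty model serves.
    · exact ⟨fun _ => Classical.arbitrary A, fun h => absurd h hθ⟩

/-- The formula `∃ x x_r, ψ(x, σ(x), x_r, b̃)` with parameters `b̃`. -/
noncomputable def solutionFormula {V : Type*} {n r l : ℕ} (ψ : L.Formula (Fin (n + n + r) ⊕ Fin l))
    (bt : Fin l → V) : (LSigma L).Formula V :=
  Formula.iExs (Fin n ⊕ Fin r) (BoundedFormula.subst (LHom.sumInl.onFormula ψ)
    (Sum.elim (Fin.append (Fin.append (fun i => (Term.var (Sum.inr (Sum.inl i))))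
      (fun i => sigmaTerm (Term.var (Sum.inr (Sum.inl i)))))
      (fun i => Term.var (Sum.inr (Sum.inr i)))) (fun i => Term.var (Sum.inl (bt i)))))

theorem realize_solutionFormula {V : Type*} {n r l : ℕ} (ψ : L.Formula (Fin (n + n + r) ⊕ Fin l))
    (bt : Fin l → V) (e : V → A) :
    (solutionFormula ψ bt).Realize e ↔ ∃ (x : Fin n → A) (xr : Fin r → A),
      ψ.Realize (Sum.elim (Fin.append (Fin.append x (fun i => sigmaMap L (x i))) xr)
        (fun i => e (bt i))) := by
  simp only [solutionFormula, Formula.realize_iExs, realize_subst_onFormula,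
    realize_append_sigmaTerm]
  exact ⟨fun ⟨d, hd⟩ => ⟨_, _, hd⟩, fun ⟨x, xr, hx⟩ => ⟨Sum.elim x xr, hx⟩⟩

end Expansion

/-! ### Models of $T_\sigma$ as models of $T$ with an automorphism -/

section Models

variable {L : FirstOrder.Language.{u, v}} {T : L.Theory}

instance leftStructure_isExpansionOn (M : ModelOf (TSigma T)) :
    (LHom.sumInl : L →ᴸ LSigma L).IsExpansionOn M :=
  LHom.isExpansionOn_reduct _ _

/-- The model of `T` underlying a model of `T_σ`. -/
abbrev baseModel (M : ModelOf (TSigma T)) : ModelOf T :=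
  have : M ⊨ T := ((model_TSigma_iff T).1 M.is_model).1
  Theory.ModelType.of T M

theorem modelOf_TSigma (M : ModelOf (TSigma T)) :
    Function.Bijective (sigmaMap L : M → M) ∧
      (∀ (n : ℕ) (f : L.Functions n) (x : Fin n → M),
        sigmaMap L (Structure.funMap f x) = Structure.funMap f (fun i => sigmaMap L (x i))) ∧
      (∀ (n : ℕ) (r : L.Relations n) (x : Fin n → M),
        Structure.RelMap r x ↔ Structure.RelMap r (fun i => sigmaMap L (x i))) :=
  ((model_TSigma_iff T).1 M.is_model).2

/-- The automorphism of a model of `T_σ`. -/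
noncomputable def baseAut (M : ModelOf (TSigma T)) : baseModel M ≃[L] baseModel M where
  toEquiv := Equiv.ofBijective (sigmaMap L : M → M) (modelOf_TSigma M).1
  map_fun' f x := (modelOf_TSigma M).2.1 _ f x
  map_rel' r x := ((modelOf_TSigma M).2.2 _ r x).symm

/-- The `L_σ`-structure given by an `L`-structure and a map. -/
abbrev autStructure {M : Type w} [L.Structure M] (σ : M → M) : (LSigma L).Structure M :=
  letI := sigmaStructure σ
  inferInstance

theorem autStructure_model {M : ModelOf T} (σ : M ≃[L] M) :
    let _ := autStructure (L := L) σ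
    M ⊨ TSigma T := by
  let _ := sigmaStructure σ
  exact (model_TSigma_iff T).2 ⟨M.is_model, σ.bijective, fun n f x => σ.map_fun f x,
    fun n r x => (σ.map_rel r x).symm⟩

/-- The model of `T_σ` given by a model of `T` and an automorphism. -/
def autModel {M : ModelOf T} (σ : M ≃[L] M) : ModelOf (TSigma T) :=
  letI := autStructure (L := L) σ
  haveI := autStructure_model σ
  Theory.ModelType.of (TSigma T) M

end Models

/-! ### Embedding models of $T_\sigma$ into models of TA -/

section Existence

variable {L : FirstOrder.Language.{u, v}} {T : L.Theory}

theorem realize_of_pointwise_eq {α : Type w} {N : Type w'} [L.Structure N] {φ : L.Formula α}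
    {e e' : α → N} (h : φ.Realize e) (he : ∀ i, e i = e' i) : φ.Realize e' :=
  funext he ▸ h

/-- Embeddings of models of `T_σ` are `L`-elementary. -/
def baseElementary (hT : IsModelComplete T) {M N : ModelOf (TSigma T)} (g : M ↪[LSigma L] N) :
    baseModel M ↪ₑ[L] baseModel N where
  toFun := g
  map_formula' _ φ a :=
    let e : M ↪[L] N := reductEmbedding g
    hT (baseModel M) (baseModel N) e _ φ a

/-- An elementary embedding of the underlying models which commutes with the automorphisms. -/
def embeddingOfBase {M N : ModelOf (TSigma T)} (q : baseModel M ↪ₑ[L] baseModel N)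
    (h : ∀ x, q (baseAut M x) = baseAut N (q x)) : M ↪[LSigma L] N :=
  let e : M ↪[L] N := q.toEmbedding
  expandEmbedding e h

/-- Extending a model of `T_σ` by an elementary extension of its underlying model with a compatible
automorphism. -/
def autEmbedding {M : ModelOf (TSigma T)} {N : ModelOf T} (τ : N ≃[L] N)
    (q : baseModel M ↪ₑ[L] N) (h : ∀ x, τ (q x) = q (baseAut M x)) : M ↪[LSigma L] autModel τ :=
  embeddingOfBase (N := autModel τ) q fun x => (h x).symm

/-- `ψ`, `θ` and `θ'` define a geometric axiom, via some nice formula `φ`. -/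
def IsAxiomData (R : GenericityRelation T) {n r l k : ℕ} (ψ : L.Formula (Fin (n + n + r) ⊕ Fin l))
    (θ θ' : L.Formula (Fin l ⊕ Fin k)) : Prop :=
  ∃ φ : L.Formula (Fin n ⊕ Fin k), NiceFormula R ψ ∧ NiceFormula R φ ∧
    DefinesProjection R (fstBlock n r) ψ φ θ ∧ DefinesProjection R (sndBlock n r) ψ φ θ'

/-- The model and the nice types that gave rise to an axiom can be forgotten: `θ` and `θ'` alone
guarantee the projections in every model of `T`. -/
theorem exists_isAxiomData_of_mem {R : GenericityRelation T} {s : (LSigma L).Sentence}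
    (hs : s ∈ geometricAxioms R) :
    ∃ (n r l k : ℕ) (ψ : L.Formula (Fin (n + n + r) ⊕ Fin l)) (θ θ' : L.Formula (Fin l ⊕ Fin k)),
      IsAxiomData R ψ θ θ' ∧ s = geometricAxiom ψ θ θ' := by
  obtain ⟨M, σ, n, r, l, k, pt, p, p', ψ, bt, φ, b, θ, θ', -, -, -, -, -, -, hψ, -, hφ, -, -, -, -,
    hθ, -, hθ', rfl⟩ := hs
  exact ⟨n, r, l, k, ψ, θ, θ', ⟨φ, hψ, hφ, hθ, hθ'⟩, rfl⟩

theorem append_blocks {α : Type*} {n r : ℕ} (c : Fin (n + n + r) → α) :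
    Fin.append (Fin.append (fun i => c (fstBlock n r i)) (fun i => c (sndBlock n r i)))
      (fun i => c (Fin.natAdd (n + n) i)) = c := by
  funext i
  refine Fin.addCases (fun i => ?_) (fun i => ?_) i
  · refine Fin.addCases (fun i => ?_) (fun i => ?_) i
    · simp only [Fin.append_left]; rfl
    · simp only [Fin.append_left, Fin.append_right]; rfl
  · simp only [Fin.append_right]

theorem map_append_blocks {A : Type w} {B : Type w'} {f : A → B} {s : A → A} {t : B → B}
    (h : ∀ a, f (s a) = t (f a)) {n r l : ℕ} (x : Fin n → A) (xr : Fin r → A) {z : Fin l → A}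
    {z' : Fin l → B} (hz : ∀ i, f (z i) = z' i) (i : Fin (n + n + r) ⊕ Fin l) :
    f (Sum.elim (Fin.append (Fin.append x (fun i => s (x i))) xr) z i) =
      Sum.elim (Fin.append (Fin.append (fun i => f (x i)) (fun i => t (f (x i))))
        (fun i => f (xr i))) z' i := by
  rcases i with i | i
  · refine Fin.addCases (fun i => ?_) (fun i => ?_) i
    · refine Fin.addCases (fun i => ?_) (fun i => ?_) i
      · simp only [Sum.elim_inl, Fin.append_left]
      · simp only [Sum.elim_inl, Fin.append_left, Fin.append_right, h]
    · simp only [Sum.elim_inl, Fin.append_right]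
  · exact hz i

/-- An instance of a geometric axiom can be solved in an extension. -/
theorem exists_solution {R : GenericityRelation T} (hR : IsGeometric R) {n r l k : ℕ}
    {ψ : L.Formula (Fin (n + n + r) ⊕ Fin l)} {θ θ' : L.Formula (Fin l ⊕ Fin k)}
    (hd : IsAxiomData R ψ θ θ') {M : ModelOf T} (σ : M ≃[L] M) (bt : Fin l → M) (b : Fin k → M)
    (hθ : θ.Realize (Sum.elim bt b)) (hθ' : θ'.Realize (Sum.elim bt (fun i => σ (b i)))) :
    ∃ (N : ModelOf T) (τ : N ≃[L] N) (q : M ↪ₑ[L] N), (∀ x, τ (q x) = q (σ x)) ∧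
      ∃ (x : Fin n → N) (xr : Fin r → N), ψ.Realize
        (Sum.elim (Fin.append (Fin.append x (fun i => τ (x i))) xr) (fun i => q (bt i))) := by
  obtain ⟨φ, hψ, hφ, hdef, hdef'⟩ := hd
  obtain ⟨hne, himp, hproj⟩ := hdef M bt b hθ
  obtain ⟨-, himp', hproj'⟩ := hdef' M bt _ hθ'
  obtain ⟨pt, hpt⟩ := (hψ M bt hne).exists
  obtain ⟨c₀, hc₀⟩ := hne
  obtain ⟨p, hp⟩ := (hφ M b ⟨_, himp c₀ hc₀⟩).exists
  obtain ⟨p', hp', huniq⟩ := hφ M (fun i => σ (b i)) ⟨_, himp' c₀ hc₀⟩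
  obtain ⟨q, hq⟩ := exists_image_type σ p
  -- Invariance makes $\sigma(p)$ generic in $\varphi(x',\sigma(b))$, and niceness of `φ` allows
  -- only one such type.
  obtain rfl : q = p' := huniq q ((hR.invariance M M σ n k p q φ b hq).1 hp)
  obtain ⟨K, i, c, hc⟩ := exists_realization pt
  have ha := (hc.projectsTo_iff _ _).1 (hproj pt p hpt hp)
  have ha' := (hc.projectsTo_iff _ _).1 (hproj' pt q hpt hp')
  obtain ⟨N, τ, g, hg, hτ⟩ := exists_automorphism_extension σ i _ _
    (realize_iff_of_finite_blocks fun m χ d =>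
      (ha m χ d).symm.trans ((hq m χ d).trans (ha' m χ _)))
  refine ⟨N, τ, g.comp i, hg, fun j => g (c (fstBlock n r j)),
    fun j => g (c (Fin.natAdd (n + n) j)), ?_⟩
  have hτ' : (fun j => τ (g (c (fstBlock n r j)))) = fun j => g (c (sndBlock n r j)) := funext hτ
  rw [hτ', append_blocks (fun j => g (c j))]
  have := (hc l ψ bt).1 (R.inType_of_generic hpt)
  rw [← g.map_formula, Sum.comp_elim] at this
  exact this

/-- The property of a model `N` extending `M` that every instance of a geometric axiom with
parameters in `M` has a solution in `N`. -/
def SolvesOver (R : GenericityRelation T) {M N : ModelOf (TSigma T)} (g : M → N) : Prop :=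
  ∀ (n r l k : ℕ) (ψ : L.Formula (Fin (n + n + r) ⊕ Fin l)) (θ θ' : L.Formula (Fin l ⊕ Fin k)),
    IsAxiomData R ψ θ θ' → ∀ (bt : Fin l → M) (b : Fin k → M), θ.Realize (Sum.elim bt b) →
    θ'.Realize (Sum.elim bt (fun i => sigmaMap L (b i))) → ∃ (x : Fin n → N) (xr : Fin r → N),
      ψ.Realize (Sum.elim (Fin.append (Fin.append x (fun i => sigmaMap L (x i))) xr)
        (fun i => g (bt i)))

/-- `χ` can be forced to hold: every extension of `M` has an extension all of whose extensions
satisfy `χ`. -/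
def Forced (M : ModelOf (TSigma T)) (χ : (LSigma L).Formula M) : Prop :=
  ∀ (N : ModelOf (TSigma T)) (f : M ↪[LSigma L] N),
    ∃ (N' : ModelOf (TSigma T)) (g : N ↪[LSigma L] N'),
      ∀ (N'' : ModelOf (TSigma T)) (h : N' ↪[LSigma L] N''), χ.Realize fun x => h (g (f x))

theorem Forced.of_forall {M : ModelOf (TSigma T)} {χ : (LSigma L).Formula M}
    (h : ∀ (N : ModelOf (TSigma T)) (f : M ↪[LSigma L] N), χ.Realize f) : Forced M χ :=
  fun N f => ⟨N, Embedding.refl _ _, fun N'' g => h N'' (g.comp f)⟩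

/-- Force `χ` first and then `χ'` above it; `χ` is not lost, because forcing demands truth in all
further extensions. -/
theorem Forced.inf {M : ModelOf (TSigma T)} {χ χ' : (LSigma L).Formula M} (h : Forced M χ)
    (h' : Forced M χ') : Forced M (χ ⊓ χ') := by
  intro N f
  obtain ⟨N₁, g₁, h₁⟩ := h N f
  obtain ⟨N₂, g₂, h₂⟩ := h' N₁ (g₁.comp f)
  refine ⟨N₂, g₂.comp g₁, fun N'' e => ?_⟩
  rw [Formula.realize_inf]
  exact ⟨h₁ N'' (e.comp g₂), h₂ N'' e⟩

/-- Some extension realizes everything which can be forced. -/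
theorem exists_realize_forced (M : ModelOf (TSigma T)) :
    ∃ (N : ModelOf (TSigma T)) (g : M ↪[LSigma L] N), ∀ χ, Forced M χ → χ.Realize g := by
  obtain ⟨N, _, _, c, hc⟩ := exists_realize_of_inf_closed {χ | Forced M χ}
    ⟨⊤, Forced.of_forall fun N f => by simp⟩ (fun _ h _ h' => h.inf h')
    (fun χ h => by
      obtain ⟨N', g, hN'⟩ := h M (Embedding.refl _ _)
      exact ⟨N', inferInstance, inferInstance, _, hN' N' (Embedding.refl _ _)⟩)
  -- The axioms of $T_\sigma$, and below the quantifier-free diagram of `M`, hold in every extension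
  -- of `M` and so are forced.
  have hN : N ⊨ TSigma T := ⟨fun s hs => by
    have := hc (Formula.relabel Empty.elim s) (Forced.of_forall fun N f => by
      rw [Formula.realize_relabel, Unique.eq_default (_ ∘ _)]
      exact Theory.realize_sentence_of_mem _ hs)
    rwa [Formula.realize_relabel, Unique.eq_default (_ ∘ _)] at this⟩
  let g : M ↪[LSigma L] N :=
    { toFun := c
      inj' := fun x y hxy => by
        by_contra hne
        have := hc (Term.equal (Term.var x) (Term.var y)).not (Forced.of_forall fun N f => by
          rw [Formula.realize_not, Formula.realize_equal]
          exact fun h => hne (f.injective h))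
        rw [Formula.realize_not, Formula.realize_equal] at this
        exact this hxy
      map_fun' := fun f x => by
        have := hc (Term.equal (Term.var (Structure.funMap f x)) (Term.func f fun i => Term.var (x i)))
          (Forced.of_forall fun N e => by
            rw [Formula.realize_equal]
            exact e.map_fun f x)
        rw [Formula.realize_equal] at this
        exact this
      map_rel' := fun r x => by
        constructor
        · intro h
          by_contra hne
          have := hc (r.formula fun i => Term.var (x i)).not (Forced.of_forall fun N e => by
            rw [Formula.realize_not, Formula.realize_rel]
            exact fun h => hne ((e.map_rel r x).1 h))
          rw [Formula.realize_not, Formula.realize_rel] at this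
          exact this h
        · intro h
          have := hc (r.formula fun i => Term.var (x i)) (Forced.of_forall fun N e => by
            rw [Formula.realize_rel]
            exact (e.map_rel r x).2 h)
          rw [Formula.realize_rel] at this
          exact this }
  exact ⟨Theory.ModelType.of (TSigma T) N, g, hc⟩

/-- All instances of geometric axioms over a model can be solved simultaneously in an extension. -/
theorem exists_solvesOver (hT : IsModelComplete T) {R : GenericityRelation T}
    (hR : IsGeometric R) (M : ModelOf (TSigma T)) :
    ∃ (N : ModelOf (TSigma T)) (g : M ↪[LSigma L] N), SolvesOver R g := by
  obtain ⟨N, g, hg⟩ := exists_realize_forced M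
  refine ⟨N, g, fun n r l k ψ θ θ' hd bt b hθ hθ' => ?_⟩
  -- Solvability is forced: over any extension a further one contains a solution, which persists
  -- because embeddings are elementary for `L`.
  refine (realize_solutionFormula ψ bt g).1 (hg _ fun N' f => ?_)
  have key : ∀ (χ : L.Formula (Fin l ⊕ Fin k)) (v : Fin l ⊕ Fin k → M), χ.Realize v →
      χ.Realize (fun i => f (v i)) := fun χ v h => ((baseElementary hT f).map_formula χ v).2 h
  obtain ⟨K, τ, q, hq, x, xr, hx⟩ := exists_solution hR hd (baseAut N') (fun i => f (bt i))
    (fun i => f (b i))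
    (realize_of_pointwise_eq (key θ _ hθ) fun i => by rcases i with i | i <;> rfl)
    (realize_of_pointwise_eq (key θ' _ hθ') fun i => by
      rcases i with i | i
      · rfl
      · exact map_sigmaMap f (b i))
  refine ⟨autModel τ, autEmbedding τ q hq, fun N'' h => (realize_solutionFormula ψ bt _).2 ?_⟩
  refine ⟨fun i => h (x i), fun i => h (xr i), ?_⟩
  exact realize_of_pointwise_eq (((baseElementary hT h).map_formula ψ _).2 hx)
    (map_append_blocks (map_sigmaMap h) x xr fun _ => rfl)

/-- Every model of `T_σ` embeds into a model of the geometric axioms. -/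
theorem exists_embedding_geometric (hT : IsModelComplete T) {R : GenericityRelation T}
    (hR : IsGeometric R) (M : ModelOf (TSigma T)) :
    ∃ N : ModelOf (TSigma T ∪ geometricAxioms R), Nonempty (M ↪[LSigma L] N) := by
  choose F g hF using exists_solvesOver hT hR
  let G : ℕ → ModelOf (TSigma T) := fun n => Nat.rec (motive := fun _ => ModelOf (TSigma T)) M (fun _ K => F K) n
  let j : ∀ n, baseModel (G n) ↪ₑ[L] baseModel (G (n + 1)) := fun n => baseElementary hT (g (G n))
  have hj : ∀ n x, j n (baseAut (G n) x) = baseAut (G (n + 1)) (j n x) :=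
    fun n x => map_sigmaMap (g (G n)) x
  obtain ⟨N, ι, E, hι, hex, hE⟩ := ModelOf.exists_limit (fun n => baseModel (G n)) j
    (fun n => (j n).comp (baseAut (G n)).toElementaryEmbedding)
    (fun n x => congrArg (j (n + 1)) (hj n x).symm)
  have hE' : ∀ n x, E (ι n x) = ι n (baseAut (G n) x) := fun n x => (hE n x).trans (hι n _)
  let τ : N ≃[L] N := equivOfSurjective E fun y => by
    obtain ⟨n, x, rfl⟩ := hex y
    exact ⟨ι n ((baseAut (G n)).symm x),
      (hE' n _).trans (congrArg (ι n) ((baseAut (G n)).apply_symm_apply x))⟩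
  have hτ : ∀ n x, τ (ι n x) = ι n (baseAut (G n) x) := hE'
  have hmodel : autModel τ ⊨ TSigma T ∪ geometricAxioms R := by
    refine Theory.model_union_iff.2 ⟨(autModel τ).is_model, ⟨fun s hs => ?_⟩⟩
    obtain ⟨n, r, l, k, ψ, θ, θ', hd, rfl⟩ := exists_isAxiomData_of_mem hs
    refine (realize_geometricAxiom ψ θ θ').2 fun bt b hθ hθ' => ?_
    -- The parameters appear at a stage `m`, and stage `m + 1` was built to solve every instance
    -- over it.
    obtain ⟨m, z, hz⟩ := exists_common_level (G := fun n => baseModel (G n))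
      (j := fun n => j n) (ι := fun n => ι n) hι hex (Sum.elim bt b)
    have hbt : ∀ i, bt i = ι m (z (Sum.inl i)) := fun i => (hz (Sum.inl i)).symm
    have hb : ∀ i, b i = ι m (z (Sum.inr i)) := fun i => (hz (Sum.inr i)).symm
    obtain ⟨x, xr, hx⟩ := hF (G m) n r l k ψ θ θ' hd (fun i => z (Sum.inl i))
      (fun i => z (Sum.inr i))
      (by
        refine ((ι m).map_formula θ _).1 (realize_of_pointwise_eq hθ fun i => ?_)
        rcases i with i | i
        · exact hbt i
        · exact hb i)
      (by
        refine ((ι m).map_formula θ' _).1 (realize_of_pointwise_eq hθ' fun i => ?_)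
        rcases i with i | i
        · exact hbt i
        · exact (congrArg τ (hb i)).trans (hτ m _))
    refine ⟨fun i => ι (m + 1) (x i), fun i => ι (m + 1) (xr i), ?_⟩
    exact realize_of_pointwise_eq (((ι (m + 1)).map_formula ψ _).2 hx)
      (map_append_blocks (fun y => (hτ (m + 1) y).symm) x xr fun i =>
        (hι m _).trans (hbt i).symm)
  exact ⟨Theory.ModelType.of _ (autModel τ), ⟨autEmbedding τ (ι 0) (hτ 0)⟩⟩

end Existence

/-! ### Existential closedness and model-completeness -/

section ModelCompleteness

variable {L : FirstOrder.Language.{u, v}} {T : L.Theory}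

theorem ProjectsTo.trans {M : ModelOf T} {n n₁ n₂ : ℕ} {f : Fin n₁ → Fin n} {g : Fin n₂ → Fin n₁}
    {p : TypesOver M n} {p₁ : TypesOver M n₁} {p₂ : TypesOver M n₂} (h : ProjectsTo f p p₁)
    (h' : ProjectsTo g p₁ p₂) : ProjectsTo (f ∘ g) p p₂ := by
  obtain ⟨N, j, a, ha⟩ := exists_realization p
  have ha₁ := (ha.projectsTo_iff f p₁).1 h
  exact ha.projectsTo ((ha₁.projectsTo_iff g p₂).1 h')

theorem strictMono_fstBlock (n r : ℕ) : StrictMono (fstBlock n r) := fun _ _ h => h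

theorem strictMono_sndBlock (n r : ℕ) : StrictMono (sndBlock n r) := fun _ _ h =>
  Nat.add_lt_add_left h n

/-- The image of a nice type under an automorphism is nice. -/
theorem NiceType.image {R : GenericityRelation T} (hR : IsGeometric R) {M : ModelOf T}
    (σ : M ≃[L] M) {n : ℕ} {p q : TypesOver M n} (hp : NiceType R p)
    (h : RestrictsTo σ.toElementaryEmbedding q p) : NiceType R q := by
  intro l χ c hχ
  have hc : (fun i => σ (σ.symm (c i))) = c := funext fun i => σ.apply_symm_apply (c i)
  obtain ⟨k, ψ, b, hψ, hgen, himp⟩ := hp l χ (fun i => σ.symm (c i)) ((h l χ _).2 (by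
    change InType q χ (fun i => σ (σ.symm (c i)))
    rwa [hc]))
  refine ⟨k, ψ, fun i => σ (b i), hψ, (hR.invariance M M σ n k p q ψ b h).1 hgen, fun a ha => ?_⟩
  have key : ∀ (m : ℕ) (ξ : L.Formula (Fin n ⊕ Fin m)) (d : Fin m → M),
      ξ.Realize (Sum.elim (fun i => σ.symm (a i)) d) ↔
        ξ.Realize (Sum.elim a (fun i => σ (d i))) := by
    intro m ξ d
    rw [← σ.toElementaryEmbedding.map_formula]
    congr! 1
    funext i
    rcases i with i | i
    · exact σ.apply_symm_apply (a i)
    · rfl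
  have := (key _ _ _).1 (himp _ ((key _ _ _).2 ha))
  rwa [hc] at this

/-- A tuple in an extension of `(M, σ)` lies, in some further extension, in a tuple whose type over `M`
is nice. -/
theorem exists_nice_extension {R : GenericityRelation T} (hR : IsGeometric R) {M N : ModelOf T}
    (ρ : N ≃[L] N) (f : M ↪ₑ[L] N) {n : ℕ} (a : Fin n → N) :
    ∃ (K : ModelOf T) (τ : K ≃[L] K) (q : N ↪ₑ[L] K) (d : ℕ) (c : Fin (n + d) → K)
      (p : TypesOver M (n + d)), (∀ x, τ (q x) = q (ρ x)) ∧ (∀ i, c (Fin.castAdd d i) = q (a i)) ∧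
        NiceType R p ∧ Realizes (q.comp f) c p := by
  obtain ⟨p₀, hp₀⟩ := exists_realizes f a
  obtain ⟨d, p, hp, hproj⟩ := hR.enough_nice_types M n p₀
  obtain ⟨N₁, j₁, a₁, ha₁⟩ := exists_realization p
  have ha₁' := (ha₁.projectsTo_iff _ _).1 hproj
  -- The extra coordinates live in `N₁`, which carries no automorphism. Amalgamating over `M` and
  -- `a` brings them above `N`; then `ρ` is extended, with no tuple prescribed.
  obtain ⟨K, g, g₁, hg⟩ := ModelOf.exists_amalgam N N₁ (Sum.elim a f)
    (Sum.elim (a₁ ∘ Fin.castAdd d) j₁)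
    (realize_iff_of_finite_blocks fun m χ b => (hp₀ m χ b).symm.trans (ha₁' m χ b))
  obtain ⟨N₂, τ, q, hq, -⟩ := exists_automorphism_extension (α := Empty) ρ g Empty.elim Empty.elim
    (fun φ => by
      have h₁ : (Sum.elim Empty.elim g : Empty ⊕ N → K) = g ∘ Sum.elim Empty.elim id := by
        funext i; rcases i with i | i
        · exact i.elim
        · rfl
      have h₂ : (Sum.elim Empty.elim (g ∘ ρ) : Empty ⊕ N → K) =
          (g.comp ρ.toElementaryEmbedding) ∘ Sum.elim Empty.elim id := by
        funext i; rcases i with i | i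
        · exact i.elim
        · rfl
      rw [h₁, h₂, ElementaryEmbedding.map_formula, ElementaryEmbedding.map_formula])
  refine ⟨N₂, τ, q.comp g, d, fun i => q (g₁ (a₁ i)), p, hq,
    fun i => congrArg q (hg (Sum.inl i)).symm, hp, fun m ψ b => ?_⟩
  rw [ha₁ m ψ b, ← (q.comp g₁).map_formula, Sum.comp_elim]
  congr! 2
  funext i
  exact congrArg q (hg (Sum.inr (b i))).symm

/-- In a model of the geometric axioms one can solve all `L`-formulas in `x` and `σ(x)` which can be
solved in an extension. -/
theorem exists_solution_of_extension {R : GenericityRelation T} (hR : IsGeometric R)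
    {M N : ModelOf T} (σ : M ≃[L] M) (ρ : N ≃[L] N) (f : M ↪ₑ[L] N)
    (hf : ∀ x, ρ (f x) = f (σ x))
    (hM : ∀ {n r l k : ℕ} (ψ : L.Formula (Fin (n + n + r) ⊕ Fin l))
      (θ θ' : L.Formula (Fin l ⊕ Fin k)), geometricAxiom ψ θ θ' ∈ geometricAxioms R →
      SatisfiesAxiom σ ψ θ θ')
    {n k : ℕ} (χ : L.Formula ((Fin n ⊕ Fin n) ⊕ Fin k)) (a : Fin n → N) (m : Fin k → M)
    (h : χ.Realize (Sum.elim (Sum.elim a (fun i => ρ (a i))) (fun i => f (m i)))) :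
    ∃ a' : Fin n → M, χ.Realize (Sum.elim (Sum.elim a' (fun i => σ (a' i))) m) := by
  obtain ⟨K, τ, q, d, c, p, hq, hc, hp, hcp⟩ := exists_nice_extension hR ρ f a
  set j := q.comp f with hj
  have hτ : ∀ x, τ (j x) = j (σ x) := fun x => (hq _).trans (congrArg q (hf x))
  obtain ⟨p', hp'⟩ := exists_realizes j (fun i => τ (c i))
  have hres : RestrictsTo σ.toElementaryEmbedding p' p := hcp.restrictsTo σ hp' fun m φ b => by
    rw [← τ.toElementaryEmbedding.map_formula, Sum.comp_elim]
    congr! 2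
    funext i
    exact hτ (b i)
  obtain ⟨pt₀, hpt₀⟩ := exists_realizes j (Fin.append c (fun i => τ (c i)))
  obtain ⟨r, pt, hpt, hproj⟩ := hR.enough_nice_types M _ pt₀
  have hfst : ProjectsTo (fstBlock (n + d) r) pt p := hproj.trans (hpt₀.projectsTo (by
    convert hcp using 1
    funext i
    exact Fin.append_left _ _ i))
  have hsnd : ProjectsTo (sndBlock (n + d) r) pt p' := hproj.trans (hpt₀.projectsTo (by
    convert hp' using 1
    funext i
    exact Fin.append_right _ _ i))
  -- Any member of $N(p)$ will do, so niceness is applied to the trivial formula.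
  obtain ⟨k₀, φ, b, hφ, hgen, -⟩ := hp 0 ⊤ Fin.elim0 ((hcp _ _ _).2 (by simp))
  have hgen' : R.Generic p' φ (fun i => σ (b i)) := (hR.invariance M M σ _ _ p p' φ b hres).1 hgen
  -- `Ξ` gathers what `ψ` must imply: $\varphi(x,b)$ and $\varphi(x',\sigma(b))$, required by the
  -- axiom, and `χ` on the coordinates of the original tuple. All of `M` serves as parameters until
  -- a finite tuple is extracted.
  let Ξ : L.Formula (Fin (n + d + (n + d) + r) ⊕ M) :=
    (φ.relabel (Sum.map (fstBlock (n + d) r) b) ⊓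
      φ.relabel (Sum.map (sndBlock (n + d) r) (fun i => σ (b i)))) ⊓
    χ.relabel (Sum.map (Sum.elim (fun i => fstBlock (n + d) r (Fin.castAdd d i))
      (fun i => sndBlock (n + d) r (Fin.castAdd d i))) m)
  have hΞ : ∀ {N : ModelOf T} (e : Fin (n + d + (n + d) + r) → N) (i : M → N),
      Ξ.Realize (Sum.elim e i) ↔
        (φ.Realize (Sum.elim (e ∘ fstBlock (n + d) r) (i ∘ b)) ∧
          φ.Realize (Sum.elim (e ∘ sndBlock (n + d) r) (i ∘ fun i => σ (b i)))) ∧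
        χ.Realize (Sum.elim (Sum.elim (fun i => e (fstBlock (n + d) r (Fin.castAdd d i)))
          (fun i => e (sndBlock (n + d) r (Fin.castAdd d i)))) (i ∘ m)) := by
    intro N e i
    simp only [Ξ, Formula.realize_inf, Formula.realize_relabel, Sum.elim_comp_map, Sum.comp_elim]
    rfl
  obtain ⟨l₀, c₀, Ξ', -, hΞ'⟩ := exists_finite_block.{u, v, 0, max u v, max u v} Ξ
  obtain ⟨N', i, e, he⟩ := exists_realization pt
  have he₀ := (he.projectsTo_iff _ _).1 hproj
  have hin : InType pt Ξ' c₀ := by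
    refine (he _ _ _).2 ((hΞ' N' e i).1 ((hΞ e i).2 ⟨⟨?_, ?_⟩, ?_⟩))
    · exact ((he.projectsTo_iff _ _).1 hfst _ _ _).1 (R.inType_of_generic hgen)
    · exact ((he.projectsTo_iff _ _).1 hsnd _ _ _).1 (R.inType_of_generic hgen')
    · let χ' : L.Formula (Fin (n + d + (n + d)) ⊕ Fin k) := χ.relabel (Sum.map (Sum.elim
        (fun i => Fin.castAdd (n + d) (Fin.castAdd d i))
        (fun i => Fin.natAdd (n + d) (Fin.castAdd d i))) id)
      have h₁ : InType pt₀ χ' m := by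
        refine (hpt₀ _ _ _).2 ?_
        rw [Formula.realize_relabel, Sum.elim_comp_map, Sum.comp_elim, Function.comp_id]
        refine realize_of_pointwise_eq ((q.map_formula χ _).2 h) fun i => ?_
        rcases i with (i | i) | i
        · simp only [Function.comp_apply, Sum.elim_inl, Fin.append_left, hc]
        · simp only [Function.comp_apply, Sum.elim_inl, Sum.elim_inr, Fin.append_right, hc, hq]
        · rfl
      have h₂ := (he₀ _ _ _).1 h₁
      rwa [Formula.realize_relabel, Sum.elim_comp_map, Sum.comp_elim, Function.comp_id] at h₂
  obtain ⟨l, ψ, bt, hψ, hψgen, himp⟩ := hpt _ _ _ hin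
  have himp' : ∀ a : Fin (n + d + (n + d) + r) → M, ψ.Realize (Sum.elim a bt) →
      Ξ.Realize (Sum.elim a id) := fun a ha => (hΞ' M a id).2 (himp a ha)
  have hif : Implies M (fstBlock (n + d) r) ψ bt φ b := fun a ha =>
    ((hΞ a id).1 (himp' a ha)).1.1
  have his : Implies M (sndBlock (n + d) r) ψ bt φ (fun i => σ (b i)) := fun a ha =>
    ((hΞ a id).1 (himp' a ha)).1.2
  obtain ⟨θ, hθ, hθd⟩ := hR.definability _ _ _ _ _ (strictMono_fstBlock _ _) ψ φ hψ hφ M bt b pt p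
    hψgen hgen hif hfst
  obtain ⟨θ', hθ', hθd'⟩ := hR.definability _ _ _ _ _ (strictMono_sndBlock _ _) ψ φ hψ hφ M bt _
    pt p' hψgen hgen' his hsnd
  obtain ⟨x, xr, hx⟩ := hM ψ θ θ' ⟨M, σ, n + d, r, l, k₀, pt, p, p', ψ, bt, φ, b, θ, θ', hpt, hp,
    hp.image hR σ hres, hfst, hsnd, hres, hψ, hψgen, hφ, hgen, hif, his, hθ, hθd, hθ', hθd', rfl⟩
    bt b hθ hθ'
  refine ⟨fun i => x (Fin.castAdd d i), realize_of_pointwise_eq ((hΞ _ id).1 (himp' _ hx)).2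
    fun i => ?_⟩
  rcases i with (i | i) | i
  · simp only [Sum.elim_inl, fstBlock, Fin.append_left]
  · simp only [Sum.elim_inl, Sum.elim_inr, sndBlock, Fin.append_left, Fin.append_right]
  · rfl

/-- Only finitely many variables of each block occur in a formula; the first two blocks are treated
uniformly. -/
theorem exists_finite_double_block {β : Type w} {γ : Type w'} (χ : L.Formula ((β ⊕ β) ⊕ γ)) :
    ∃ (n k : ℕ) (b : Fin n → β) (d : Fin k → γ) (χ' : L.Formula ((Fin n ⊕ Fin n) ⊕ Fin k)),
      Function.Injective b ∧ ∀ (N : Type x) [L.Structure N] (s s' : β → N) (c : γ → N),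
        χ.Realize (Sum.elim (Sum.elim s s') c) ↔
          χ'.Realize (Sum.elim (Sum.elim (s ∘ b) (s' ∘ b)) (c ∘ d)) := by
  classical
  -- The union makes a single tuple index both blocks, so that the second can be the image of the
  -- first under σ.
  let S : Finset β := χ.freeVarFinset.toLeft.toLeft ∪ χ.freeVarFinset.toLeft.toRight
  let e := S.equivFin
  let S' : Finset γ := χ.freeVarFinset.toRight
  let e' := S'.equivFin
  let f : χ.freeVarFinset → (Fin S.card ⊕ Fin S.card) ⊕ Fin S'.card := fun y =>
    match y with
    | ⟨Sum.inl (Sum.inl y), h⟩ => Sum.inl (Sum.inl (e ⟨y, Finset.mem_union_left _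
        (Finset.mem_toLeft.2 (Finset.mem_toLeft.2 h))⟩))
    | ⟨Sum.inl (Sum.inr y), h⟩ => Sum.inl (Sum.inr (e ⟨y, Finset.mem_union_right _
        (Finset.mem_toRight.2 (Finset.mem_toLeft.2 h))⟩))
    | ⟨Sum.inr y, h⟩ => Sum.inr (e' ⟨y, Finset.mem_toRight.2 h⟩)
  refine ⟨S.card, S'.card, fun i => (e.symm i : β), fun i => (e'.symm i : γ),
    χ.restrictFreeVar f, Subtype.val_injective.comp e.symm.injective, fun N _ s s' c => ?_⟩
  refine (BoundedFormula.realize_restrictFreeVar (φ := χ) (f := f)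
    (Sum.elim (Sum.elim s s') c) ?_).symm
  rintro ⟨(y | y) | y, hy⟩ <;> simp [f]

/-- A model `M` of the geometric axioms is existentially closed: every extension of `M` embeds over
`M` into an elementary extension of `M`. -/
theorem exists_elementary_extension_of_geometric (hT : IsModelComplete T)
    {R : GenericityRelation T} (hR : IsGeometric R)
    (M N : ModelOf (TSigma T ∪ geometricAxioms R)) (f : M ↪[LSigma L] N) :
    ∃ (K : ModelOf (TSigma T ∪ geometricAxioms R)) (j : M ↪ₑ[LSigma L] K)
      (g : N ↪[LSigma L] K), ∀ x, g (f x) = j x := by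
  let M₀ : ModelOf (TSigma T) := M.subtheoryModel Set.subset_union_left
  let N₀ : ModelOf (TSigma T) := N.subtheoryModel Set.subset_union_left
  let f₀ : M₀ ↪[LSigma L] N₀ := f
  have hax : ∀ {n r l k : ℕ} (ψ : L.Formula (Fin (n + n + r) ⊕ Fin l))
      (θ θ' : L.Formula (Fin l ⊕ Fin k)), geometricAxiom ψ θ θ' ∈ geometricAxioms R →
      SatisfiesAxiom (baseAut M₀) ψ θ θ' := fun ψ θ θ' hs =>
    (realize_geometricAxiom (A := M₀) ψ θ θ').1 (M.is_model.realize_of_mem _ (Or.inr hs))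
  let t : (N₀ ⊕ N₀) ⊕ M₀ → (LSigma L).Term (M₀ ⊕ N₀) :=
    Sum.elim (Sum.elim (fun y => Term.var (Sum.inr y)) (fun y => sigmaTerm (Term.var (Sum.inr y))))
      (fun x => Term.var (Sum.inl x))
  have ht : ∀ (A : Type (max u v)) [(LSigma L).Structure A] (j : M₀ → A) (c : N₀ → A),
      (fun i => (t i).realize (Sum.elim j c)) =
        Sum.elim (Sum.elim c (fun y => sigmaMap L (c y))) j := by
    intro A _ j c
    funext i
    rcases i with (i | i) | i
    · rfl
    · exact realize_sigmaTerm _ _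
    · rfl
  -- Each `y` in `N₀` gets two variables, for `y` and for `σ(y)`; the second is later replaced by
  -- the term `σ` of the first. Equations in `D` therefore record how σ acts on `N₀` and how `M₀`
  -- sits in it.
  let D : Set (L.Formula ((N₀ ⊕ N₀) ⊕ M₀)) :=
    {χ | χ.Realize (Sum.elim (Sum.elim id (sigmaMap L : N₀ → N₀)) f₀)}
  obtain ⟨K, _, _, j, c, hc⟩ := exists_elementary_extension (L := LSigma L) M₀ (β := N₀)
    {ξ | ∃ χ ∈ D, ξ = BoundedFormula.subst (LHom.sumInl.onFormula χ) t}
    (by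
      rintro _ ⟨χ, hχ, rfl⟩ _ ⟨χ', hχ', rfl⟩
      refine ⟨_, ⟨χ ⊓ χ', Formula.realize_inf.2 ⟨hχ, hχ'⟩, rfl⟩, fun c hc => ?_⟩
      rw [realize_subst_onFormula, Formula.realize_inf] at hc
      rwa [realize_subst_onFormula, realize_subst_onFormula])
    (by
      rintro _ ⟨χ, hχ, rfl⟩
      obtain ⟨n, k, b, d, χ', hb, hχ'⟩ :=
        exists_finite_double_block.{u, v, max u v, max u v, max u v} χ
      obtain ⟨a', ha'⟩ := exists_solution_of_extension hR (baseAut M₀) (baseAut N₀)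
        (baseElementary hT f₀) (fun x => (map_sigmaMap f₀ x).symm) hax χ' b d
        ((hχ' N₀ id (sigmaMap L) f₀).1 hχ)
      -- Elements of `N₀` outside the tuple `b` do not occur in the formula, so their values are
      -- arbitrary.
      let c := Function.extend b a' (fun _ => Classical.arbitrary M₀)
      have hcb : ∀ i, c (b i) = a' i := fun i => hb.extend_apply _ _ i
      refine ⟨c, (realize_subst_onFormula χ t _).2 ?_⟩
      refine realize_of_pointwise_eq ((hχ' M₀ c (fun y => sigmaMap L (c y)) id).2
        (realize_of_pointwise_eq ha' fun i => ?_)) fun i => (congrFun (ht M₀ id c) i).symm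
      rcases i with (i | i) | i
      · exact (hcb i).symm
      · exact congrArg (sigmaMap L) (hcb i).symm
      · rfl)
    ⟨_, ⊤, by simp [D], rfl⟩
  let K₁ : ModelOf (TSigma T ∪ geometricAxioms R) :=
    modelOfElementary (M := M) j
  let K₀ : ModelOf (TSigma T) := K₁.subtheoryModel Set.subset_union_left
  have hc' : ∀ χ ∈ D, χ.Realize (M := K₀) (Sum.elim (Sum.elim c (fun y => sigmaMap L (c y))) j) := by
    intro χ hχ
    exact realize_of_pointwise_eq ((realize_subst_onFormula (A := K₀) χ t _).1 (hc _ ⟨χ, hχ, rfl⟩))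
      fun i => congrFun (ht K j c) i
  let e : baseModel N₀ ↪ₑ[L] baseModel K₀ :=
    ⟨c, fun n φ x => by
      have hpos : ∀ φ : L.Formula (Fin n), φ.Realize x → φ.Realize (M := K₀) (c ∘ x) := by
        intro φ h
        have := hc' (φ.relabel (fun i => Sum.inl (Sum.inl (x i))))
          (by change Formula.Realize _ _; rwa [Formula.realize_relabel])
        rwa [Formula.realize_relabel] at this
      refine ⟨fun h => ?_, hpos φ⟩
      by_contra hn
      exact hpos φ.not (by rwa [Formula.realize_not]) h⟩
  have he : ∀ y, e (baseAut N₀ y) = baseAut K₀ (e y) := fun y => by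
    have := hc' (Term.equal (Term.var (Sum.inl (Sum.inl (sigmaMap L y))))
      (Term.var (Sum.inl (Sum.inr y)))) (Formula.realize_equal.2 rfl)
    exact Formula.realize_equal.1 this
  refine ⟨K₁, j, embeddingOfBase (M := N₀) (N := K₀) e he, fun x => ?_⟩
  have := hc' (Term.equal (Term.var (Sum.inl (Sum.inl (f x)))) (Term.var (Sum.inr x)))
    (Formula.realize_equal.2 rfl)
  exact Formula.realize_equal.1 this

/-- Robinson's test. -/
theorem isModelComplete_of_exists_elementary_extension {L' : FirstOrder.Language.{u, v}}
    {T' : L'.Theory}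
    (h : ∀ (M N : ModelOf T') (f : M ↪[L'] N),
      ∃ (K : ModelOf T') (j : M ↪ₑ[L'] K) (g : N ↪[L'] K), ∀ x, g (f x) = j x) :
    IsModelComplete T' := by
  have key : ∀ {α : Type} {l : ℕ} (φ : L'.BoundedFormula α l) (M N : ModelOf T') (f : M ↪[L'] N)
      (v : α → M) (xs : Fin l → M), φ.Realize (f ∘ v) (f ∘ xs) ↔ φ.Realize v xs := by
    intro α l φ
    induction φ with
    | falsum => intros; rfl
    | equal t₁ t₂ =>
      intro M N f v xs
      simp [BoundedFormula.Realize, ← Sum.comp_elim, HomClass.realize_term]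
    | rel R ts =>
      intro M N f v xs
      simp only [BoundedFormula.Realize, ← Sum.comp_elim, HomClass.realize_term]
      exact f.map_rel R _
    | imp φ ψ h₁ h₂ => intro M N f v xs; simp only [BoundedFormula.realize_imp, h₁, h₂]
    | all φ ih =>
      intro M N f v xs
      simp only [BoundedFormula.realize_all]
      constructor
      · intro hN x
        rw [← ih M N f, Fin.comp_snoc]
        exact hN _
      -- A universal statement true in `M` passes to `K` along the elementary `j`; its instance at
      -- `g y` descends to `N` by the induction hypothesis for `g`.
      · intro hM y
        obtain ⟨K, j, g, hg⟩ := h M N f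
        rw [← ih N K g, Fin.comp_snoc]
        have hj := (j.map_boundedFormula φ.all v xs).2 (BoundedFormula.realize_all.2 hM)
        have hgv : g ∘ f ∘ v = j ∘ v := funext fun i => hg _
        have hgx : g ∘ f ∘ xs = j ∘ xs := funext fun i => hg _
        rw [hgv, hgx]
        exact BoundedFormula.realize_all.1 hj _
  intro M N f n φ a
  have := key φ M N f a default
  rwa [Unique.eq_default (f ∘ default)] at this

end ModelCompleteness

end GenericAutomorphism

open GenericAutomorphism in
theorem propositionP {L : FirstOrder.Language.{u, v}} (T : L.Theory)
    (hcomplete : T.IsComplete) (hmodelComplete : IsModelComplete T) (hstable : IsStable T)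
    (R : GenericityRelation T) (hR : IsGeometric R) :
    IsModelCompanion (TSigma T) (TSigma T ∪ geometricAxioms R) :=
  ⟨isModelComplete_of_exists_elementary_extension
      (exists_elementary_extension_of_geometric hmodelComplete hR),
    exists_embedding_geometric hmodelComplete hR,
    fun N => ⟨N.subtheoryModel Set.subset_union_left, ⟨Embedding.refl _ _⟩⟩⟩
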